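/- Let $\mathcal M$ be a (finite-dimensional, smooth, connected) Riemannian manifold with distance $d$, and let $\mathcal X\subset\mathcal M$ be compact and geodesically convex: any two points $x,y\in\mathcal X$ are joined by a minimizing geodesic $\gamma_{xy}:[0,1]\to\mathcal M$ contained in $\mathcal X$, unique among the minimizing geodesics contained in $\mathcal X$. For $x,y\in\mathcal X$ write $\mathrm{Exp}_x^{-1}(y)=\dot\gamma_{xy}(0)\in T_x\mathcal M$, let $\Gamma_x^y:T_x\mathcal M\to T_y\mathcal M$ be parallel transport along $\gamma_{xy}$ (Borel measurable jointly in $(x,u,y)$), and let $D=\mathrm{diam}(\mathcal X)$. A function $f$ is called $L$-smooth on $\mathcal X$ if it is differentiable at the points of $\mathcal X$ and $\|\mathrm{grad} f(y)-\Gamma_x^y\,\mathrm{grad} f(x)\|\le L\,d(x,y)$ for all $x,y\in\mathcal X$, and g-convex on $\mathcal X$ if $f(y)\ge f(x)+\langle \mathrm{grad} f(x),\mathrm{Exp}_x^{-1}(y)\rangle$ for all $x,y\in\mathcal X$. Let $L>0$, and consider one of the following two problems. * Stochastic: $\Phi(x)=\mathbb E_{\xi\sim\mathcal P}[\phi(x,\xi)]$,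 where $\Phi$ and (for $\mathcal P$-almost every $\xi$) $\phi(\cdot,\xi)$ are $L$-smooth on $\mathcal X$, $\mathrm{grad}\,\phi(x,\xi)$ is jointly measurable in $(x,\xi)$, $\|\mathrm{grad}\,\phi(x,\xi)\|\le C$ for all $x\in\mathcal X$ and $\mathcal P$-almost every $\xi$, and $\mathbb E_\xi[\mathrm{grad}\,\phi(x,\xi)]=\mathrm{grad}\,\Phi(x)$ for $x\in\mathcal X$. Put $m=\infty$. * Finite sum: $\Phi(x)=\frac1m\sum_{i=1}^m\phi_i(x)$ with $m\ge1$, where each $\phi_i$ is $L$-smooth on $\mathcal X$ and has a Borel measurable gradient field there. Samples $\xi$ are uniform indices $i\in\{1,\dots,m\}$. For $K\ge 1$, the method SPIDER-RFW is run for $K$ iterations with the parameters $$\eta=\tfrac1{\sqrt K},\qquad \epsilon=\tfrac1{\sqrt K},\qquad n=\lceil\sqrt K\rceil,\qquad |S_1|=\Big\lceil \tfrac{2C^2}{\epsilon^2}\Big\rceil\ \text{(stochastic)},\qquad |S_1|=\Big\lceil\tfrac{2L^2D^2}{\epsilon^2}\Big\rceil\ \text{(finite sum)}.$$ Starting from $x_0\in\mathcal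 X$, iteration $k=0,\dots,K-1$ is as follows. 1. If $n\mid k$, draw a fresh i.i.d. batch $S_1$ and set $g_k=\mathrm{grad}\,\Phi_{S_1}(x_k)$. Otherwise put $|S_2|=\big\lceil\min\{m,\,2nL^2\|\mathrm{Exp}_{x_{k-1}}^{-1}(x_k)\|/\epsilon^2\}\big\rceil$, draw a fresh i.i.d. batch $S_2$ of this size (in the finite-sum case, if $|S_2|=m$, let $S_2$ be the whole index set, each index once), and set $g_k=\mathrm{grad}\,\Phi_{S_2}(x_k)-\Gamma_{x_{k-1}}^{x_k}\big(\mathrm{grad}\,\Phi_{S_2}(x_{k-1})-g_{k-1}\big)$. 2. Choose $z_{k+1}\in\arg\min_{z\in\mathcal X}\langle g_k,\mathrm{Exp}_{x_k}^{-1}(z)\rangle$ and set $x_{k+1}=\gamma_{x_kz_{k+1}}(\eta)$. Here $\mathrm{grad}\,\Phi_S(x)$ is the average of the component gradients at $x$ over the batch $S$ (zero if $S$ is empty), the samples of iteration $k$ are independent of everything that precedes them, and the iterates are measurable with respect to the past. The output $\hat x$ is drawn uniformly from $\{x_0,\dots,x_{K-1}\}$, independently of the run. If $\Phi$ is g-convex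 on $\mathcal X$ and $x^*\in\arg\min_{\mathcal X}\Phi$, then the expected optimality gap is $O(1/\sqrt K)$: there is a constant $A$, depending on the problem but not on $K$, on $x_0$ or on the run, such that for every $K\ge1$ and every such run $$\mathbb E[\Phi(\hat x)-\Phi(x^*)]\le \frac{A}{\sqrt K}\qquad\text{and}\qquad \mathbb E[\Phi(x_K)-\Phi(x^*)]\le \frac{A}{\sqrt K}.$$ -/

import Mathlib

open scoped Manifold ContDiff
open Bundle MeasureTheory ProbabilityTheory Set

namespace SpiderRFW

noncomputable section

section Geometry

variable {E : Type*} [NormedAddCommGroup E] [NormedSpace ℝ E] [FiniteDimensional ℝ E]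
  {M : Type*} [MetricSpace M] [ChartedSpace E M] [IsManifold 𝓘(ℝ, E) ∞ M]
  [RiemannianBundle (fun x : M => TangentSpace 𝓘(ℝ, E) x)]

/-- The tangent bundle carries its Borel σ-algebra. -/
instance instMeasurableSpaceTangentBundle : MeasurableSpace (TangentBundle 𝓘(ℝ, E) M) :=
  borel _

/-- The coefficients `G_y(a, b)` of the Riemannian metric in the chart around `p`, as a function of
the coordinate point `y`: the inner product of the two tangent vectors with coordinates `a`, `b`. -/
def metricCoeff (p : M) (y a b : E) : ℝ :=
  inner ℝ
    ((trivializationAt E (TangentSpace 𝓘(ℝ, E)) p).symm ((extChartAt 𝓘(ℝ, E) p).symm y) a)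
    ((trivializationAt E (TangentSpace 𝓘(ℝ, E)) p).symm ((extChartAt 𝓘(ℝ, E) p).symm y) b)

/-- The derivative of the metric coefficients, `(∂_w G)_y(a, b)`. -/
def dMetricCoeff (p : M) (y w a b : E) : ℝ :=
  fderiv ℝ (fun y' => metricCoeff p y' a b) y w

/-- `V`, a curve in the tangent bundle defined on `[0,1]`, is a parallel vector field (for the
Levi-Civita connection) along its base curve `c`. At each `t`, in the chart around `c t`, with `u`
the velocity of `c`, `v` the coordinates of `V` and `v'` their derivative, the equation
`∇_{c'} V = 0` is tested against all `w`; lowering the index of the Christoffel symbols it reads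
`G(v', w) + ½ ((∂_u G)(v, w) + (∂_v G)(u, w) - (∂_w G)(u, v)) = 0`. -/
def IsParallel (V : ℝ → TangentBundle 𝓘(ℝ, E) M) : Prop :=
  ∀ t ∈ Icc (0 : ℝ) 1,
    let p : M := (V t).proj
    let y : E := extChartAt 𝓘(ℝ, E) p p
    let coordBase : ℝ → E := fun s => extChartAt 𝓘(ℝ, E) p (V s).proj
    let coordVec : ℝ → E := fun s => (trivializationAt E (TangentSpace 𝓘(ℝ, E)) p (V s)).2
    let u : E := derivWithin coordBase (Icc 0 1) t
    let v : E := coordVec t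
    let v' : E := derivWithin coordVec (Icc 0 1) t
    DifferentiableWithinAt ℝ coordVec (Icc 0 1) t ∧
      ∀ w : E, metricCoeff p y v' w +
        (dMetricCoeff p y u v w + dMetricCoeff p y v u w - dMetricCoeff p y w u v) / 2 = 0

/-- The velocity field of a curve `c : [0,1] → M`. -/
def velocity (c : ℝ → M) (t : ℝ) : TangentBundle 𝓘(ℝ, E) M :=
  ⟨c t, mfderivWithin 𝓘(ℝ, ℝ) 𝓘(ℝ, E) c (Icc 0 1) t (1 : ℝ)⟩

variable (E) in
/-- `c : [0,1] → M` is a minimizing geodesic from `x` to `y`: a smooth curve with parallel velocity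
whose length is the distance between its endpoints. -/
structure IsMinGeodesic (c : ℝ → M) (x y : M) : Prop where
  smooth : ContMDiffOn 𝓘(ℝ, ℝ) 𝓘(ℝ, E) ∞ c (Icc 0 1)
  source : c 0 = x
  target : c 1 = y
  geodesic : IsParallel (velocity (E := E) c)
  minimizing : Manifold.pathELength 𝓘(ℝ, E) c 0 1 = edist x y

variable (E) in
/-- `X` is geodesically convex: any two of its points are joined by a minimizing geodesic that stays
in `X`, and only by one (so that `Exp_x⁻¹(y)` is well defined for `x, y ∈ X`). -/
def GeodesicallyConvex (X : Set M) : Prop :=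
  ∀ x ∈ X, ∀ y ∈ X,
    (∃ c : ℝ → M, IsMinGeodesic E c x y ∧ MapsTo c (Icc 0 1) X) ∧
    ∀ c c' : ℝ → M, IsMinGeodesic E c x y → MapsTo c (Icc 0 1) X →
      IsMinGeodesic E c' x y → MapsTo c' (Icc 0 1) X → EqOn c c' (Icc 0 1)

variable (E) in
/-- The geodesic map, the inverse exponential map and the parallel transport on `X`. Each of the
three maps is pinned down on `X` by its definition (when minimizing geodesics in `X` are unique):
* `γ x y` is the minimizing geodesic in `X` from `x` to `y`;
* `Log x y = Exp_x⁻¹(y)` is the initial velocity of `γ x y`;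
* `Γ x y u` is the endpoint of the parallel field along `γ x y` that starts at `u`. -/
structure GeodesicMaps (X : Set M) where
  γ : M → M → ℝ → M
  Log : ∀ x : M, M → TangentSpace 𝓘(ℝ, E) x
  Γ : ∀ x y : M, TangentSpace 𝓘(ℝ, E) x →ₗ[ℝ] TangentSpace 𝓘(ℝ, E) y
  isMinGeodesic : ∀ x ∈ X, ∀ y ∈ X, IsMinGeodesic E (γ x y) x y
  mapsTo : ∀ x ∈ X, ∀ y ∈ X, MapsTo (γ x y) (Icc 0 1) X
  log_eq : ∀ x ∈ X, ∀ y ∈ X,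
    (⟨x, Log x y⟩ : TangentBundle 𝓘(ℝ, E) M) = velocity (E := E) (γ x y) 0
  transport_eq : ∀ x ∈ X, ∀ y ∈ X, ∀ u : TangentSpace 𝓘(ℝ, E) x,
    ∃ V : ℝ → TangentBundle 𝓘(ℝ, E) M, IsParallel V ∧ (∀ t ∈ Icc (0 : ℝ) 1, (V t).proj = γ x y t) ∧
      V 0 = ⟨x, u⟩ ∧ V 1 = ⟨y, Γ x y u⟩

/-- Parallel transport is Borel measurable on `X`, jointly in `(x, u, y) ↦ Γ_x^y u`. -/
def MeasurableTransport [MeasurableSpace M] {X : Set M} (geo : GeodesicMaps E X) : Prop :=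
  Measurable fun q : {q : TangentBundle 𝓘(ℝ, E) M × M // q.1.proj ∈ X ∧ q.2 ∈ X} =>
    (⟨q.1.2, geo.Γ q.1.1.proj q.1.2 q.1.1.snd⟩ : TangentBundle 𝓘(ℝ, E) M)

variable (E) in
/-- The Riemannian gradient of `f` at `x`: the vector of `T_x M` representing the differential. -/
def grad (f : M → ℝ) (x : M) : TangentSpace 𝓘(ℝ, E) x :=
  haveI : FiniteDimensional ℝ (TangentSpace 𝓘(ℝ, E) x) := inferInstanceAs (FiniteDimensional ℝ E)
  haveI : CompleteSpace (TangentSpace 𝓘(ℝ, E) x) := FiniteDimensional.complete ℝ _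
  (InnerProductSpace.toDual ℝ (TangentSpace 𝓘(ℝ, E) x)).symm (mfderiv 𝓘(ℝ, E) 𝓘(ℝ, ℝ) f x)

/-- `f` is `L`-smooth on `X`: differentiable, with `‖grad f(y) - Γ_x^y grad f(x)‖ ≤ L d(x, y)`. -/
def LSmoothOn {X : Set M} (geo : GeodesicMaps E X) (L : ℝ) (f : M → ℝ) : Prop :=
  (∀ x ∈ X, MDifferentiableAt 𝓘(ℝ, E) 𝓘(ℝ, ℝ) f x) ∧
    ∀ x ∈ X, ∀ y ∈ X, ‖grad E f y - geo.Γ x y (grad E f x)‖ ≤ L * dist x y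

/-- `f` is g-convex on `X`: `f(y) ≥ f(x) + ⟨grad f(x), Exp_x⁻¹(y)⟩`. -/
def GConvexOn {X : Set M} (geo : GeodesicMaps E X) (f : M → ℝ) : Prop :=
  ∀ x ∈ X, ∀ y ∈ X, f x + inner ℝ (grad E f x) (geo.Log x y) ≤ f y

/-- `grad Φ_S(x)` for the batch `S = (s 0, …, s (b - 1))`: the average of `b` component gradients
(an empty average is `0`). -/
def batchGrad {Ξ : Type*} (φ : M → Ξ → ℝ) (b : ℕ) (s : ℕ → Ξ) (x : M) : TangentSpace 𝓘(ℝ, E) x :=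
  (b : ℝ)⁻¹ • ∑ i ∈ Finset.range b, grad E (fun x' => φ x' (s i)) x

/-- `grad Φ_S(x)` for the inner batches of a finite sum of `m` terms with requested size `r`: the
batch has `b = ⌈min {m, r}⌉` terms; it is the first `b` entries of the i.i.d. sample `s` if `b < m`,
and the whole index set (each term once) if `b = m`. -/
def cappedBatchGrad {m : ℕ} (φ : M → Fin m → ℝ) (r : ℝ) (s : ℕ → Fin m) (x : M) :
    TangentSpace 𝓘(ℝ, E) x :=
  if ⌈min (m : ℝ) r⌉₊ = m then (m : ℝ)⁻¹ • ∑ i, grad E (fun x' => φ x' i) x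
  else batchGrad φ ⌈min (m : ℝ) r⌉₊ s x

/-- The processes `ξ, x, g, z` and the index `out` form an execution of SPIDER-RFW with `K`
iterations, step size `η`, epoch length `n` and accuracy `ε` on the constraint set `X`, where samples
are drawn from `P`.
* `S₁ s x` is the gradient estimate at `x` used when an epoch starts, and `S₂ r s x` the one used
  inside an epoch with requested batch size `r`; both read the i.i.d. sample sequence `s`.
* `ℱ k` is the information available before the samples of iteration `k` are drawn.
* `ξ k i w` is the `i`-th sample drawn in iteration `k`; `z k w` is `z_{k+1}`, the output of the
  linear oracle in iteration `k`.
* The output is `x̂ = x_{out}`, with `out` uniform on `{0, …, K - 1}` and independent of the run. -/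
structure IsRun {X : Set M} (geo : GeodesicMaps E X) [MeasurableSpace M]
    {Ξ : Type*} [MeasurableSpace Ξ] (P : Measure Ξ)
    (S₁ : (ℕ → Ξ) → ∀ x : M, TangentSpace 𝓘(ℝ, E) x)
    (S₂ : ℝ → (ℕ → Ξ) → ∀ x : M, TangentSpace 𝓘(ℝ, E) x)
    (L η ε : ℝ) (n K : ℕ)
    {Ω : Type*} [mΩ : MeasurableSpace Ω] (μ : Measure Ω) (ℱ : Filtration ℕ mΩ)
    (ξ : ℕ → ℕ → Ω → Ξ) (x : ℕ → Ω → M) (g : ∀ (k : ℕ) (w : Ω), TangentSpace 𝓘(ℝ, E) (x k w))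
    (z : ℕ → Ω → M) (out : Ω → Fin K) : Prop where
  /-- The iterates are adapted and start in `X`. -/
  adapted : ∀ k ≤ K, Measurable[ℱ k] (x k)
  init_mem : ∀ w, x 0 w ∈ X
  /-- The samples of iteration `k` are i.i.d. with law `P` and independent of the past. -/
  sample_measurable : ∀ k < K, ∀ i, Measurable[ℱ (k + 1)] (ξ k i)
  sample_law : ∀ k < K, ∀ i, μ.map (ξ k i) = P
  sample_iIndep : ∀ k < K, iIndepFun (ξ k) μ
  sample_indep_past : ∀ k < K,
    Indep (MeasurableSpace.comap (fun w i => ξ k i w) MeasurableSpace.pi) (ℱ k) μ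
  /-- The gradient estimate at the beginning of an epoch. -/
  grad_epoch : ∀ k < K, k % n = 0 → ∀ w, g k w = S₁ (fun i => ξ k i w) (x k w)
  /-- The gradient estimate inside an epoch. -/
  grad_inner : ∀ k, k + 1 < K → (k + 1) % n ≠ 0 → ∀ w,
    let r : ℝ := 2 * n * L ^ 2 * ‖geo.Log (x k w) (x (k + 1) w)‖ / ε ^ 2
    let s : ℕ → Ξ := fun i => ξ (k + 1) i w
    g (k + 1) w = S₂ r s (x (k + 1) w) - geo.Γ (x k w) (x (k + 1) w) (S₂ r s (x k w) - g k w)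
  /-- The linear oracle `z_{k+1} ∈ argmin_{z ∈ X} ⟨g_k, Exp_{x_k}⁻¹(z)⟩`. -/
  oracle_mem : ∀ k < K, ∀ w, z k w ∈ X
  oracle_min : ∀ k < K, ∀ w,
    IsMinOn (fun y => inner ℝ (g k w) (geo.Log (x k w) y)) X (z k w)
  /-- The geodesic update. -/
  step : ∀ k < K, ∀ w, x (k + 1) w = geo.γ (x k w) (z k w) η
  /-- The random output index. -/
  out_measurable : Measurable out
  out_law : ∀ j, μ {w | out w = j} = (K : ENNReal)⁻¹
  out_indep : Indep (MeasurableSpace.comap out ⊤) (ℱ K) μ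

/-- The expected optimality gaps of the output `x̂` and of the final iterate `x_K` are (well defined
and) at most `A / √K`. -/
def GapBound {Ω : Type*} [MeasurableSpace Ω] (μ : Measure Ω) (Φ : M → ℝ) (xstar : M) {K : ℕ}
    (x : ℕ → Ω → M) (out : Ω → Fin K) (A : ℝ) : Prop :=
  (Integrable (fun w => Φ (x (out w) w) - Φ xstar) μ ∧
    ∫ w, (Φ (x (out w) w) - Φ xstar) ∂μ ≤ A / √(K : ℝ)) ∧
  (Integrable (fun w => Φ (x K w) - Φ xstar) μ ∧
    ∫ w, (Φ (x K w) - Φ xstar) ∂μ ≤ A / √(K : ℝ))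

end Geometry

end

end SpiderRFW

/-! The argument is the Frank–Wolfe recursion with a variance-reduced gradient. Write `D` for the
diameter of `X`, `Δ_k` for the expected gap at `x_k` and `e_k = ‖g_k - grad Φ(x_k)‖`. Descent along
the geodesic to the oracle point, minimality of that point compared with `xstar`, and g-convexity
give `Δ_{k+1} ≤ (1 - η) Δ_k + η (2 D E[e_k] + L D² η / 2)` (`IsRun.gap_succ_le`). With `η = 1/√K` it
is enough that `E[e_k] = O(1/√K)`. Then the bracket is at most `C/√K`. Unrolling the recursion
bounds `Δ_K`, because `(1 - 1/√K)^K ≤ 1/√K`. Telescoping it bounds the average of `Δ_0, …, Δ_{K-1}`,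
which is the expected gap of the random output.

For the gradient error, an epoch starts with mean square error at most `c₁/K`. Each inner step adds
at most `c₂/(nK)`: its error is the parallel transport of the previous error plus a centred average
of the independent vectors `grad φ(y,ξ) - Γ grad φ(x,ξ)`, of norm at most `L d(x,y)`. The cross term
has mean zero since the fresh samples are independent of the past, and transport is an isometry. An
epoch has fewer than `n` inner steps, so `E[e_k²] ≤ (c₁ + c₂)/K` throughout
(`IsRun.meanSqError_le`).

The geometry comes directly from the coordinate equation of parallel fields. It shows that inner
products of parallel fields are constant (`IsParallel.inner_eq`), so transport is isometric and
unique and minimizing geodesics have speed equal to the distance. Uniqueness of geodesics in `X`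
identifies the velocity of `γ x y` at `t` with the transport of `Log x y`
(`GeodesicMaps.velocity_γ`), which yields the descent inequality. Conditioning on the past requires
joint measurability of all estimators as maps into the tangent bundle; this is reduced to Euclidean
coordinates by choosing, measurably, one of countably many charts. -/

namespace SpiderRFW

open Filter Topology

set_option linter.unusedSectionVars false
set_option synthInstance.maxHeartbeats 400000

/-! ### The Riemannian metric in charts and its derivative -/

section ParallelTransport

variable {E : Type*} [NormedAddCommGroup E] [NormedSpace ℝ E] [FiniteDimensional ℝ E]
  {M : Type*} [MetricSpace M] [ChartedSpace E M] [IsManifold 𝓘(ℝ, E) ∞ M]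
  [RiemannianBundle (fun x : M => TangentSpace 𝓘(ℝ, E) x)]

/-- The Riemannian metric in the chart around `p`, as a continuous bilinear form. -/
noncomputable def metricForm (p : M) (y : E) : E →L[ℝ] E →L[ℝ] ℝ :=
  (innerSL ℝ (E := TangentSpace 𝓘(ℝ, E) ((extChartAt 𝓘(ℝ, E) p).symm y))).bilinearComp
    ((trivializationAt E (TangentSpace 𝓘(ℝ, E)) p).symmL ℝ ((extChartAt 𝓘(ℝ, E) p).symm y))
    ((trivializationAt E (TangentSpace 𝓘(ℝ, E)) p).symmL ℝ ((extChartAt 𝓘(ℝ, E) p).symm y))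

theorem metricForm_apply {p : M} {y : E} (hy : y ∈ (extChartAt 𝓘(ℝ, E) p).target) (a b : E) :
    metricForm p y a b = metricCoeff p y a b := by
  have h : (extChartAt 𝓘(ℝ, E) p).symm y ∈
      (trivializationAt E (TangentSpace 𝓘(ℝ, E)) p).baseSet := by
    have := (extChartAt 𝓘(ℝ, E) p).map_target hy
    simpa using this
  simp only [metricForm, metricCoeff, ContinuousLinearMap.bilinearComp_apply]
  rw [Trivialization.symmL_apply _ h, Trivialization.symmL_apply _ h]
  rfl

theorem metricForm_symm (p : M) (y a b : E) : metricForm p y a b = metricForm p y b a := by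
  simp only [metricForm, ContinuousLinearMap.bilinearComp_apply]
  exact real_inner_comm (F := TangentSpace 𝓘(ℝ, E) ((extChartAt 𝓘(ℝ, E) p).symm y)) _ _

variable [IsContMDiffRiemannianBundle 𝓘(ℝ, E) ∞ E (fun x : M => TangentSpace 𝓘(ℝ, E) x)]

/-- A constant coordinate vector is a smooth local section of the tangent bundle, and the bundle
metric pairs such sections smoothly. One derivative is all that the parallel equation needs. -/
theorem contDiffOn_metricCoeff (p : M) (a b : E) :
    ContDiffOn ℝ 1 (fun y => metricCoeff p y a b) (extChartAt 𝓘(ℝ, E) p).target := by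
  rw [← contMDiffOn_iff_contDiffOn]
  have h1 : ContMDiffOn 𝓘(ℝ, E) 𝓘(ℝ, E) 1 (extChartAt 𝓘(ℝ, E) p).symm
      (extChartAt 𝓘(ℝ, E) p).target := contMDiffOn_extChartAt_symm p
  have hs : ∀ a : E, ContMDiffOn 𝓘(ℝ, E) (𝓘(ℝ, E).prod 𝓘(ℝ, E)) 1
      (fun y => ((⟨(extChartAt 𝓘(ℝ, E) p).symm y,
        (trivializationAt E (TangentSpace 𝓘(ℝ, E)) p).symm ((extChartAt 𝓘(ℝ, E) p).symm y) a⟩ :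
          TangentBundle 𝓘(ℝ, E) M))) (extChartAt 𝓘(ℝ, E) p).target := by
    intro a
    have h2 : ContMDiffOn 𝓘(ℝ, E) (𝓘(ℝ, E).prod 𝓘(ℝ, E)) 1
      (fun y => ((extChartAt 𝓘(ℝ, E) p).symm y, a)) (extChartAt 𝓘(ℝ, E) p).target :=
      h1.prodMk contMDiffOn_const
    have h3 := (Trivialization.contMDiffOn_symm (n := 1) (IB := 𝓘(ℝ, E))
      (trivializationAt E (TangentSpace 𝓘(ℝ, E) : M → Type _) p)).comp h2 (by
        intro y hy
        have := (extChartAt 𝓘(ℝ, E) p).map_target hy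
        rw [mem_preimage, Trivialization.mem_target]
        simpa using this)
    refine h3.congr fun y hy => ?_
    have h : (extChartAt 𝓘(ℝ, E) p).symm y ∈
        (trivializationAt E (TangentSpace 𝓘(ℝ, E)) p).baseSet := by
      have := (extChartAt 𝓘(ℝ, E) p).map_target hy
      simpa using this
    exact Trivialization.mk_symm _ h a
  have := ContMDiffOn.inner_bundle (IB := 𝓘(ℝ, E)) (F := E)
    (E := (TangentSpace 𝓘(ℝ, E) : M → Type _)) (n := 1) (hs a) (hs b)
  exact this

theorem contDiffOn_metricForm (p : M) :
    ContDiffOn ℝ 1 (fun y => metricForm p y) (extChartAt 𝓘(ℝ, E) p).target := by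
  rw [contDiffOn_clm_apply]
  intro a
  rw [contDiffOn_clm_apply]
  intro b
  exact (contDiffOn_metricCoeff p a b).congr fun y hy => metricForm_apply hy a b

theorem hasFDerivAt_metricForm (p : M) {y : E} (hy : y ∈ (extChartAt 𝓘(ℝ, E) p).target) :
    HasFDerivAt (fun y => metricForm p y) (fderiv ℝ (fun y => metricForm p y) y) y :=
  (((contDiffOn_metricForm p).contDiffAt
    ((isOpen_extChartAt_target p).mem_nhds hy)).differentiableAt one_ne_zero).hasFDerivAt

/-- Makes the derivative of the metric linear in all three slots, so that the parallel equation can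
be scaled and differentiated by the product rule. -/
theorem dMetricCoeff_eq (p : M) {y : E} (hy : y ∈ (extChartAt 𝓘(ℝ, E) p).target) (w a b : E) :
    dMetricCoeff p y w a b = fderiv ℝ (fun y => metricForm p y) y w a b := by
  have h : (fun y' => metricCoeff p y' a b) =ᶠ[𝓝 y] fun y' => metricForm p y' a b := by
    filter_upwards [(isOpen_extChartAt_target p).mem_nhds hy] with z hz
    exact (metricForm_apply hz a b).symm
  rw [dMetricCoeff, h.fderiv_eq]
  have h1 := ((hasFDerivAt_metricForm p hy).clm_apply (hasFDerivAt_const a y)).clm_apply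
    (hasFDerivAt_const b y)
  rw [h1.fderiv]
  simp

end ParallelTransport

/-! ### Parallel fields have constant inner products -/

theorem hasDerivWithinAt_clm_family {E F G : Type*} [NormedAddCommGroup E] [NormedSpace ℝ E]
    [NormedAddCommGroup F] [NormedSpace ℝ F] [NormedAddCommGroup G] [NormedSpace ℝ G]
    {B : E → F →L[ℝ] G} {B' : E →L[ℝ] F →L[ℝ] G} {y : ℝ → E} {v : ℝ → F} {u : E} {v' : F}
    {s : Set ℝ} {t : ℝ} (hB : HasFDerivAt B B' (y t)) (hy : HasDerivWithinAt y u s t)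
    (hv : HasDerivWithinAt v v' s t) :
    HasDerivWithinAt (fun r => B (y r) (v r)) (B' u (v t) + B (y t) v') s t := by
  have h1 : HasDerivWithinAt (fun r => B (y r)) (B' u) s t := hB.comp_hasDerivWithinAt t hy
  exact h1.clm_apply hv

theorem hasDerivWithinAt_bilinear_family {E : Type*} [NormedAddCommGroup E] [NormedSpace ℝ E]
    {B : E → E →L[ℝ] E →L[ℝ] ℝ} {B' : E →L[ℝ] E →L[ℝ] E →L[ℝ] ℝ} {y v w : ℝ → E} {u v' w' : E}
    {s : Set ℝ} {t : ℝ} (hB : HasFDerivAt B B' (y t)) (hy : HasDerivWithinAt y u s t)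
    (hv : HasDerivWithinAt v v' s t) (hw : HasDerivWithinAt w w' s t) :
    HasDerivWithinAt (fun r => B (y r) (v r) (w r))
      (B' u (v t) (w t) + B (y t) v' (w t) + B (y t) (v t) w') s t := by
  exact (hasDerivWithinAt_clm_family hB hy hv).clm_apply hw

section ParallelFields

variable {E : Type*} [NormedAddCommGroup E] [NormedSpace ℝ E] [FiniteDimensional ℝ E]
  {M : Type*} [MetricSpace M] [ChartedSpace E M] [IsManifold 𝓘(ℝ, E) ∞ M]
  [RiemannianBundle (fun x : M => TangentSpace 𝓘(ℝ, E) x)]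

theorem IsParallel.congr {V W : ℝ → TangentBundle 𝓘(ℝ, E) M} (hV : IsParallel V)
    (h : ∀ t ∈ Icc (0 : ℝ) 1, V t = W t) : IsParallel W := by
  intro t ht
  have h1 := hV t ht
  have e1 : EqOn (fun s => extChartAt 𝓘(ℝ, E) (W t).proj (W s).proj)
      (fun s => extChartAt 𝓘(ℝ, E) (W t).proj (V s).proj) (Icc 0 1) := by
    intro s hs; simp only [h s hs]
  have e2 : EqOn (fun s => (trivializationAt E (TangentSpace 𝓘(ℝ, E)) (W t).proj (W s)).2)
      (fun s => (trivializationAt E (TangentSpace 𝓘(ℝ, E)) (W t).proj (V s)).2) (Icc 0 1) := by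
    intro s hs; simp only [h s hs]
  simp only [h t ht] at h1
  refine ⟨h1.1.congr e2 (e2 ht), fun w => ?_⟩
  rw [derivWithin_congr e1 (e1 ht), derivWithin_congr e2 (e2 ht)]
  exact h1.2 w

theorem inner_eq_metricForm (p : M) {q : M} (hq : q ∈ (chartAt E p).source)
    (v w : TangentSpace 𝓘(ℝ, E) q) :
    inner ℝ v w = metricForm p (extChartAt 𝓘(ℝ, E) p q)
      (trivializationAt E (TangentSpace 𝓘(ℝ, E)) p ⟨q, v⟩).2
      (trivializationAt E (TangentSpace 𝓘(ℝ, E)) p ⟨q, w⟩).2 := by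
  have hq' : q ∈ (extChartAt 𝓘(ℝ, E) p).source := by simpa using hq
  rw [metricForm_apply ((extChartAt 𝓘(ℝ, E) p).map_source hq'), metricCoeff,
    (extChartAt 𝓘(ℝ, E) p).left_inv hq', Trivialization.symm_apply_apply_mk _ hq,
    Trivialization.symm_apply_apply_mk _ hq]

theorem differentiableWithinAt_coordBase {c : ℝ → M}
    (hc : ContMDiffOn 𝓘(ℝ, ℝ) 𝓘(ℝ, E) ∞ c (Icc 0 1)) {t : ℝ} (ht : t ∈ Icc (0 : ℝ) 1) :
    DifferentiableWithinAt ℝ (fun s => extChartAt 𝓘(ℝ, E) (c t) (c s)) (Icc 0 1) t := by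
  have h1 : MDifferentiableWithinAt 𝓘(ℝ, ℝ) 𝓘(ℝ, E) c (Icc 0 1) t :=
    (hc t ht).mdifferentiableWithinAt (by simp)
  have h2 : MDifferentiableAt 𝓘(ℝ, E) 𝓘(ℝ, E) (extChartAt 𝓘(ℝ, E) (c t)) (c t) :=
    mdifferentiableAt_extChartAt (by simp)
  exact (h2.comp_mdifferentiableWithinAt t h1).differentiableWithinAt

variable [IsContMDiffRiemannianBundle 𝓘(ℝ, E) ∞ E (fun x : M => TangentSpace 𝓘(ℝ, E) x)]

theorem IsParallel.hasDerivWithinAt_inner {c : ℝ → M}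
    (hc : ContMDiffOn 𝓘(ℝ, ℝ) 𝓘(ℝ, E) ∞ c (Icc 0 1)) {v w : ∀ t, TangentSpace 𝓘(ℝ, E) (c t)}
    (hv : IsParallel fun t => (⟨c t, v t⟩ : TangentBundle 𝓘(ℝ, E) M))
    (hw : IsParallel fun t => (⟨c t, w t⟩ : TangentBundle 𝓘(ℝ, E) M))
    {t : ℝ} (ht : t ∈ Icc (0 : ℝ) 1) :
    HasDerivWithinAt (fun s => inner ℝ (v s) (w s)) 0 (Icc 0 1) t := by
  obtain ⟨hv1, hv2⟩ := hv t ht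
  obtain ⟨hw1, hw2⟩ := hw t ht
  have hy : extChartAt 𝓘(ℝ, E) (c t) (c t) ∈ (extChartAt 𝓘(ℝ, E) (c t)).target :=
    mem_extChartAt_target (c t)
  have hB := differentiableWithinAt_coordBase hc ht
  have key := hasDerivWithinAt_bilinear_family (hasFDerivAt_metricForm (c t) hy)
    hB.hasDerivWithinAt hv1.hasDerivWithinAt hw1.hasDerivWithinAt
  have heq : (fun s => inner ℝ (v s) (w s)) =ᶠ[𝓝[Icc 0 1] t]
      fun s => metricForm (c t) (extChartAt 𝓘(ℝ, E) (c t) (c s))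
        (trivializationAt E (TangentSpace 𝓘(ℝ, E)) (c t) ⟨c s, v s⟩).2
        (trivializationAt E (TangentSpace 𝓘(ℝ, E)) (c t) ⟨c s, w s⟩).2 := by
    have h1 : ∀ᶠ s in 𝓝[Icc 0 1] t, c s ∈ (chartAt E (c t)).source :=
      (hc.continuousOn t ht).eventually
        ((chartAt E (c t)).open_source.mem_nhds (mem_chart_source E (c t)))
    filter_upwards [h1] with s hs
    exact inner_eq_metricForm (c t) hs _ _
  refine (key.congr_of_eventuallyEq heq (heq.self_of_nhdsWithin ht)).congr_deriv ?_
  -- Metric compatibility: test the equation of `v` against `w` and that of `w` against `v`. In the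
  -- sum the terms `∂_v G(u, w)` and `∂_w G(u, v)` cancel, and what remains is the product-rule
  -- derivative of `G(v, w)`.
  have e1 := hv2 (trivializationAt E (TangentSpace 𝓘(ℝ, E)) (c t) ⟨c t, w t⟩).2
  have e2 := hw2 (trivializationAt E (TangentSpace 𝓘(ℝ, E)) (c t) ⟨c t, v t⟩).2
  simp only [dMetricCoeff_eq (c t) hy, ← metricForm_apply hy] at e1 e2
  have hsymm : ∀ u a b : E, fderiv ℝ (fun y => metricForm (c t) y)
      (extChartAt 𝓘(ℝ, E) (c t) (c t)) u a b = fderiv ℝ (fun y => metricForm (c t) y)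
      (extChartAt 𝓘(ℝ, E) (c t) (c t)) u b a := by
    intro u a b
    rw [← dMetricCoeff_eq (c t) hy, ← dMetricCoeff_eq (c t) hy, dMetricCoeff, dMetricCoeff]
    congr 2
    ext y
    exact real_inner_comm _ _
  rw [metricForm_symm] at e2
  set a := (trivializationAt E (TangentSpace 𝓘(ℝ, E)) (c t) ⟨c t, v t⟩).2
  set b := (trivializationAt E (TangentSpace 𝓘(ℝ, E)) (c t) ⟨c t, w t⟩).2
  rw [hsymm _ b a] at e2
  dsimp only
  linarith

theorem IsParallel.inner_eq {c : ℝ → M}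
    (hc : ContMDiffOn 𝓘(ℝ, ℝ) 𝓘(ℝ, E) ∞ c (Icc 0 1)) {v w : ∀ t, TangentSpace 𝓘(ℝ, E) (c t)}
    (hv : IsParallel fun t => (⟨c t, v t⟩ : TangentBundle 𝓘(ℝ, E) M))
    (hw : IsParallel fun t => (⟨c t, w t⟩ : TangentBundle 𝓘(ℝ, E) M))
    {t : ℝ} (ht : t ∈ Icc (0 : ℝ) 1) : inner ℝ (v t) (w t) = inner ℝ (v 0) (w 0) := by
  refine constant_of_has_deriv_right_zero
    (f := fun s => inner ℝ (v s) (w s)) (a := 0) (b := 1)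
    (fun s hs => (IsParallel.hasDerivWithinAt_inner hc hv hw hs).continuousWithinAt)
    (fun s hs => ?_) t ht
  refine ((IsParallel.hasDerivWithinAt_inner hc hv hw
    (Ico_subset_Icc_self hs)).mono_of_mem_nhdsWithin ?_)
  exact Icc_mem_nhdsGE_of_mem hs

end ParallelFields

/-! ### Reparametrization, isometry and uniqueness of transport, minimizing geodesics -/

section Transport

variable {E : Type*} [NormedAddCommGroup E] [NormedSpace ℝ E] [FiniteDimensional ℝ E]
  {M : Type*} [MetricSpace M] [ChartedSpace E M] [IsManifold 𝓘(ℝ, E) ∞ M]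
  [RiemannianBundle (fun x : M => TangentSpace 𝓘(ℝ, E) x)]

theorem exists_section {V : ℝ → TangentBundle 𝓘(ℝ, E) M} {c : ℝ → M} {s : Set ℝ}
    (h : ∀ t ∈ s, (V t).proj = c t) :
    ∃ v : ∀ t, TangentSpace 𝓘(ℝ, E) (c t), ∀ t ∈ s, V t = ⟨c t, v t⟩ := by
  have : ∀ t, ∃ v : TangentSpace 𝓘(ℝ, E) (c t), t ∈ s → V t = ⟨c t, v⟩ := by
    intro t
    by_cases ht : t ∈ s
    · rw [← h t ht]
      exact ⟨(V t).2, fun _ => rfl⟩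
    · exact ⟨0, fun h => absurd h ht⟩
  choose v hv using this
  exact ⟨v, hv⟩

theorem differentiableWithinAt_mul_left {s t : ℝ} :
    HasDerivWithinAt (fun r : ℝ => s * r) s (Icc 0 1) t := by
  simpa using ((hasDerivAt_id t).const_mul s).hasDerivWithinAt

theorem mapsTo_mul_Icc {s : ℝ} (hs : s ∈ Icc (0 : ℝ) 1) :
    MapsTo (fun r : ℝ => s * r) (Icc 0 1) (Icc 0 1) := fun _ hr =>
  ⟨mul_nonneg hs.1 hr.1, mul_le_one₀ hs.2 hr.1 hr.2⟩

/-- The velocity vector of a curve `c : [0,1] → M`. -/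
noncomputable def vel (c : ℝ → M) (t : ℝ) : TangentSpace 𝓘(ℝ, E) (c t) :=
  mfderivWithin 𝓘(ℝ, ℝ) 𝓘(ℝ, E) c (Icc 0 1) t (1 : ℝ)

variable [IsContMDiffRiemannianBundle 𝓘(ℝ, E) ∞ E (fun x : M => TangentSpace 𝓘(ℝ, E) x)]

/-- A parallel field can be restricted to an initial segment and rescaled. -/
theorem IsParallel.restrict {c : ℝ → M} (hc : ContMDiffOn 𝓘(ℝ, ℝ) 𝓘(ℝ, E) ∞ c (Icc 0 1))
    {v : ∀ t, TangentSpace 𝓘(ℝ, E) (c t)}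
    (hv : IsParallel fun t => (⟨c t, v t⟩ : TangentBundle 𝓘(ℝ, E) M))
    {s : ℝ} (hs : s ∈ Icc (0 : ℝ) 1) (a : ℝ) :
    IsParallel fun t => (⟨c (s * t), a • v (s * t)⟩ : TangentBundle 𝓘(ℝ, E) M) := by
  intro t ht
  obtain ⟨hv1, hv2⟩ := hv (s * t) (mapsTo_mul_Icc hs ht)
  dsimp only at hv1 hv2 ⊢
  set p : M := c (s * t) with hp
  have hu : UniqueDiffWithinAt ℝ (Icc (0 : ℝ) 1) t := uniqueDiffOn_Icc zero_lt_one t ht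
  have hbase : HasDerivWithinAt (fun r => extChartAt 𝓘(ℝ, E) p (c (s * r)))
      (s • derivWithin (fun r => extChartAt 𝓘(ℝ, E) p (c r)) (Icc 0 1) (s * t)) (Icc 0 1) t :=
    HasDerivWithinAt.scomp t
      (differentiableWithinAt_coordBase hc (mapsTo_mul_Icc hs ht)).hasDerivWithinAt
      differentiableWithinAt_mul_left (mapsTo_mul_Icc hs)
  have hlin : ∀ r, c (s * r) ∈ (chartAt E p).source →
      (trivializationAt E (TangentSpace 𝓘(ℝ, E)) p ⟨c (s * r), a • v (s * r)⟩).2 =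
      a • (trivializationAt E (TangentSpace 𝓘(ℝ, E)) p ⟨c (s * r), v (s * r)⟩).2 := fun r hr =>
    ((trivializationAt E (TangentSpace 𝓘(ℝ, E)) p).linear ℝ hr).map_smul a _
  have hvec : HasDerivWithinAt
      (fun r => (trivializationAt E (TangentSpace 𝓘(ℝ, E)) p ⟨c (s * r), a • v (s * r)⟩).2)
      (a • s • derivWithin (fun r => (trivializationAt E (TangentSpace 𝓘(ℝ, E)) p
        ⟨c r, v r⟩).2) (Icc 0 1) (s * t)) (Icc 0 1) t := by
    refine ((HasDerivWithinAt.scomp t hv1.hasDerivWithinAt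
      differentiableWithinAt_mul_left (mapsTo_mul_Icc hs)).const_smul a).congr_of_eventuallyEq
      ?_ (hlin t (mem_chart_source E p))
    have h1 : ∀ᶠ r in 𝓝[Icc 0 1] t, c (s * r) ∈ (chartAt E p).source := by
      have hcc : ContinuousWithinAt (fun r => c (s * r)) (Icc 0 1) t :=
        (hc.continuousOn _ (mapsTo_mul_Icc hs ht)).comp
          (continuous_const.mul continuous_id).continuousWithinAt (mapsTo_mul_Icc hs)
      exact hcc.eventually ((chartAt E p).open_source.mem_nhds (mem_chart_source E p))
    filter_upwards [h1] with r hr using hlin r hr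
  refine ⟨hvec.differentiableWithinAt, fun w => ?_⟩
  rw [hbase.derivWithin hu, hvec.derivWithin hu, hlin t (mem_chart_source E p)]
  have e := hv2 w
  have hy : extChartAt 𝓘(ℝ, E) p p ∈ (extChartAt 𝓘(ℝ, E) p).target := mem_extChartAt_target p
  simp only [dMetricCoeff_eq p hy, ← metricForm_apply hy, map_smul,
    smul_apply, smul_eq_mul] at e ⊢
  -- Every term of the parallel equation is linear in the field and, apart from the `v'` term,
  -- linear in the base velocity; the chain rule gives `v'` the same factor `a * s`.
  linear_combination (a * s) * e

theorem vel_restrict {c : ℝ → M} (hc : ContMDiffOn 𝓘(ℝ, ℝ) 𝓘(ℝ, E) ∞ c (Icc 0 1))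
    {s : ℝ} (hs : s ∈ Icc (0 : ℝ) 1) {t : ℝ} (ht : t ∈ Icc (0 : ℝ) 1) :
    vel (E := E) (fun r => c (s * r)) t = s • vel (E := E) c (s * t) := by
  have h1 : MDifferentiableWithinAt 𝓘(ℝ, ℝ) 𝓘(ℝ, E) c (Icc 0 1) (s * t) :=
    (hc _ (mapsTo_mul_Icc hs ht)).mdifferentiableWithinAt (by simp)
  have h2 := (differentiableWithinAt_mul_left (s := s) (t := t)).hasFDerivWithinAt
  have h3 : HasMFDerivWithinAt 𝓘(ℝ, ℝ) 𝓘(ℝ, E) (c ∘ fun r => s * r) (Icc 0 1) t _ :=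
    h1.hasMFDerivWithinAt.comp t h2.hasMFDerivWithinAt (mapsTo_mul_Icc hs)
  have hu : UniqueMDiffWithinAt 𝓘(ℝ, ℝ) (Icc (0 : ℝ) 1) t :=
    (uniqueDiffOn_Icc zero_lt_one t ht).uniqueMDiffWithinAt
  have h4 := h3.mfderivWithin hu
  change mfderivWithin 𝓘(ℝ, ℝ) 𝓘(ℝ, E) (c ∘ fun r => s * r) (Icc 0 1) t (1 : ℝ) = _
  rw [h4]
  let D : ℝ →L[ℝ] E := mfderivWithin 𝓘(ℝ, ℝ) 𝓘(ℝ, E) c (Icc 0 1) (s * t)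
  have hD : D ((1 : ℝ) • s) = s • D 1 := by
    rw [← D.map_smul, smul_eq_mul, smul_eq_mul, mul_comm]
  exact hD

theorem IsParallel.norm_eq {c : ℝ → M}
    (hc : ContMDiffOn 𝓘(ℝ, ℝ) 𝓘(ℝ, E) ∞ c (Icc 0 1)) {v : ∀ t, TangentSpace 𝓘(ℝ, E) (c t)}
    (hv : IsParallel fun t => (⟨c t, v t⟩ : TangentBundle 𝓘(ℝ, E) M))
    {t : ℝ} (ht : t ∈ Icc (0 : ℝ) 1) : ‖v t‖ = ‖v 0‖ := by
  have := hv.inner_eq hc hv ht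
  rw [real_inner_self_eq_norm_sq, real_inner_self_eq_norm_sq] at this
  exact (pow_left_inj₀ (norm_nonneg _) (norm_nonneg _) two_ne_zero).1 this

/-- No ODE uniqueness is needed: expanding `‖v - w‖²` at time `1`, all three inner products keep
their initial values, so it vanishes if `v` and `w` agree at `0`. -/
theorem IsParallel.eq_of_eq_zero {c : ℝ → M}
    (hc : ContMDiffOn 𝓘(ℝ, ℝ) 𝓘(ℝ, E) ∞ c (Icc 0 1)) {V W : ℝ → TangentBundle 𝓘(ℝ, E) M}
    (hV : IsParallel V) (hW : IsParallel W) (hVc : ∀ t ∈ Icc (0 : ℝ) 1, (V t).proj = c t)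
    (hWc : ∀ t ∈ Icc (0 : ℝ) 1, (W t).proj = c t) (h0 : V 0 = W 0) : V 1 = W 1 := by
  obtain ⟨v, hv⟩ := exists_section hVc
  obtain ⟨w, hw⟩ := exists_section hWc
  have hv' := hV.congr hv
  have hw' := hW.congr hw
  have h1 : (1 : ℝ) ∈ Icc (0 : ℝ) 1 := ⟨zero_le_one, le_rfl⟩
  have h00 : (0 : ℝ) ∈ Icc (0 : ℝ) 1 := ⟨le_rfl, zero_le_one⟩
  have hvw : v 0 = w 0 := by
    rw [hv 0 h00, hw 0 h00] at h0
    exact TotalSpace.mk_inj.1 h0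
  have : ‖v 1 - w 1‖ ^ 2 = 0 := by
    rw [norm_sub_sq_real, hv'.norm_eq hc h1, hw'.norm_eq hc h1, hv'.inner_eq hc hw' h1, hvw,
      real_inner_self_eq_norm_sq]
    ring
  have h2 : v 1 = w 1 := by simpa [sub_eq_zero] using this
  rw [hv 1 h1, hw 1 h1, h2]

variable {X : Set M} (geo : GeodesicMaps E X)

theorem GeodesicMaps.norm_transport {x y : M} (hx : x ∈ X) (hy : y ∈ X)
    (u : TangentSpace 𝓘(ℝ, E) x) : ‖geo.Γ x y u‖ = ‖u‖ := by
  obtain ⟨V, hV, hVc, h0, h1⟩ := geo.transport_eq x hx y hy u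
  obtain ⟨v, hv⟩ := exists_section hVc
  have h := (hV.congr hv).norm_eq (geo.isMinGeodesic x hx y hy).smooth
    (t := 1) ⟨zero_le_one, le_rfl⟩
  have e0 := congrArg (fun V : TangentBundle 𝓘(ℝ, E) M => ‖V.2‖)
    ((hv 0 ⟨le_rfl, zero_le_one⟩).symm.trans h0)
  have e1 := congrArg (fun V : TangentBundle 𝓘(ℝ, E) M => ‖V.2‖)
    ((hv 1 ⟨zero_le_one, le_rfl⟩).symm.trans h1)
  exact e1.symm.trans (h.trans e0)

theorem GeodesicMaps.inner_transport {x y : M} (hx : x ∈ X) (hy : y ∈ X)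
    (u v : TangentSpace 𝓘(ℝ, E) x) : inner ℝ (geo.Γ x y u) (geo.Γ x y v) = inner ℝ u v :=
  LinearIsometry.inner_map_map ⟨geo.Γ x y, geo.norm_transport hx hy⟩ u v

theorem GeodesicMaps.eq_transport {x y : M} (hx : x ∈ X) (hy : y ∈ X)
    {V : ℝ → TangentBundle 𝓘(ℝ, E) M} (hV : IsParallel V)
    (hVc : ∀ t ∈ Icc (0 : ℝ) 1, (V t).proj = geo.γ x y t) {u : TangentSpace 𝓘(ℝ, E) x}
    (h0 : V 0 = ⟨x, u⟩) : V 1 = ⟨y, geo.Γ x y u⟩ := by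
  obtain ⟨W, hW, hWc, hW0, hW1⟩ := geo.transport_eq x hx y hy u
  rw [← hW1]
  exact hV.eq_of_eq_zero (geo.isMinGeodesic x hx y hy).smooth hW hVc hWc (h0.trans hW0.symm)

theorem IsMinGeodesic.norm_velocity {c : ℝ → M} {x y : M} (hc : IsMinGeodesic E c x y) {t : ℝ}
    (ht : t ∈ Icc (0 : ℝ) 1) : ‖vel (E := E) c t‖ = ‖vel (E := E) c 0‖ :=
  IsParallel.norm_eq hc.smooth (v := fun t => vel (E := E) c t) hc.geodesic ht

/-- The velocity is parallel, so the speed is constant and equals the length over `[0,1]`, which is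
the distance by minimality. -/
theorem IsMinGeodesic.norm_velocity_eq_dist {c : ℝ → M} {x y : M} (hc : IsMinGeodesic E c x y)
    {t : ℝ} (ht : t ∈ Icc (0 : ℝ) 1) : ‖vel (E := E) c t‖ = dist x y := by
  rw [hc.norm_velocity ht]
  have h := hc.minimizing
  rw [Manifold.pathELength_eq_lintegral_mfderivWithin_Icc] at h
  have h2 : ∫⁻ t in Icc (0 : ℝ) 1, ‖mfderivWithin 𝓘(ℝ, ℝ) 𝓘(ℝ, E) c (Icc 0 1) t (1 : ℝ)‖ₑ =
      ∫⁻ t in Icc (0 : ℝ) 1, ‖vel (E := E) c 0‖ₑ := by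
    refine setLIntegral_congr_fun measurableSet_Icc fun t ht => ?_
    rw [← ofReal_norm, ← ofReal_norm, ← hc.norm_velocity ht]
    rfl
  have h3 : edist x y = ‖vel (E := E) c 0‖ₑ := by
    rw [← h]
    refine h2.trans ?_
    simp
  rw [← ofReal_norm, edist_dist, ENNReal.ofReal_eq_ofReal_iff dist_nonneg (norm_nonneg _)] at h3
  exact h3.symm

variable {geo} in
theorem GeodesicMaps.norm_log {x y : M} (hx : x ∈ X) (hy : y ∈ X) :
    ‖geo.Log x y‖ = dist x y := by
  have e := congrArg (fun V : TangentBundle 𝓘(ℝ, E) M => ‖V.2‖) (geo.log_eq x hx y hy)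
  exact e.trans ((geo.isMinGeodesic x hx y hy).norm_velocity_eq_dist ⟨le_rfl, zero_le_one⟩)

/-- The two pieces of `c` are at least as long as the distances of their endpoints, while their
lengths add up to `d(x, y)`. The triangle inequality therefore forces equality for the first piece.
-/
theorem IsMinGeodesic.restrict [IsRiemannianManifold 𝓘(ℝ, E) M] {c : ℝ → M} {x y : M}
    (hc : IsMinGeodesic E c x y)
    {s : ℝ} (hs : s ∈ Icc (0 : ℝ) 1) : IsMinGeodesic E (fun t => c (s * t)) x (c s) := by
  have hsm : ContMDiffOn 𝓘(ℝ, ℝ) 𝓘(ℝ, ℝ) ∞ (fun t : ℝ => s * t) (Icc 0 1) := by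
    rw [contMDiffOn_iff_contDiffOn]
    exact (contDiff_const.mul contDiff_id).contDiffOn
  refine ⟨hc.smooth.comp hsm (mapsTo_mul_Icc hs), by simp [hc.source], by simp, ?_, ?_⟩
  · refine (IsParallel.restrict hc.smooth (v := fun t => vel (E := E) c t)
      hc.geodesic hs s).congr fun t ht => ?_
    exact congrArg (TotalSpace.mk _) (vel_restrict hc.smooth hs ht).symm
  · have h1 : Manifold.pathELength 𝓘(ℝ, E) (fun t => c (s * t)) 0 1 =
        Manifold.pathELength 𝓘(ℝ, E) c 0 s := by
      have := Manifold.pathELength_comp_of_monotoneOn (I := 𝓘(ℝ, E)) (γ := c)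
        (f := fun t : ℝ => s * t) zero_le_one
        (fun a _ b _ hab => mul_le_mul_of_nonneg_left hab hs.1)
        (fun t _ => differentiableWithinAt_mul_left.differentiableWithinAt) (by
          simp only [mul_zero, mul_one]
          exact (hc.smooth.mono (Icc_subset_Icc_right hs.2)).mdifferentiableOn (by simp))
      simp only [mul_zero, mul_one] at this
      exact this
    rw [h1]
    have h2 := Manifold.pathELength_add (I := 𝓘(ℝ, E)) (γ := c) hs.1 hs.2
    rw [hc.minimizing] at h2
    have hsm1 : ContMDiffOn 𝓘(ℝ, ℝ) 𝓘(ℝ, E) 1 c (Icc 0 1) := hc.smooth.of_le (by simp)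
    have h3 : edist x (c s) ≤ Manifold.pathELength 𝓘(ℝ, E) c 0 s := by
      rw [IsRiemannianManifold.out (I := 𝓘(ℝ, E)) x (c s)]
      exact Manifold.riemannianEDist_le_pathELength (hsm1.mono (Icc_subset_Icc_right hs.2))
        hc.source rfl hs.1
    have h4 : edist (c s) y ≤ Manifold.pathELength 𝓘(ℝ, E) c s 1 := by
      rw [IsRiemannianManifold.out (I := 𝓘(ℝ, E)) (c s) y]
      exact Manifold.riemannianEDist_le_pathELength (hsm1.mono (Icc_subset_Icc_left hs.1))
        rfl hc.target hs.2
    refine le_antisymm ?_ h3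
    -- Lengths are extended reals; finiteness of the second piece allows it to be cancelled.
    have h5 : Manifold.pathELength 𝓘(ℝ, E) c s 1 ≠ ⊤ := by
      intro h
      rw [h, add_top] at h2
      exact edist_ne_top x y h2.symm
    refine (ENNReal.add_le_add_iff_right h5).1 ?_
    rw [h2]
    exact (edist_triangle x (c s) y).trans (by gcongr)

end Transport

/-! ### Gradients and the descent inequality -/

section Descent

variable {E : Type*} [NormedAddCommGroup E] [NormedSpace ℝ E] [FiniteDimensional ℝ E]
  {M : Type*} [MetricSpace M] [ChartedSpace E M] [IsManifold 𝓘(ℝ, E) ∞ M]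
  [RiemannianBundle (fun x : M => TangentSpace 𝓘(ℝ, E) x)]

theorem inner_grad (f : M → ℝ) (x : M) (v : TangentSpace 𝓘(ℝ, E) x) :
    inner ℝ (grad E f x) v = mfderiv 𝓘(ℝ, E) 𝓘(ℝ, ℝ) f x v := by
  have : FiniteDimensional ℝ (TangentSpace 𝓘(ℝ, E) x) := inferInstanceAs (FiniteDimensional ℝ E)
  have : CompleteSpace (TangentSpace 𝓘(ℝ, E) x) := FiniteDimensional.complete ℝ _
  exact InnerProductSpace.toDual_symm_apply (𝕜 := ℝ) (E := TangentSpace 𝓘(ℝ, E) x)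

theorem grad_average {m : ℕ} {φ : M → Fin m → ℝ} {Φ : M → ℝ}
    (hΦ : ∀ x, Φ x = (1 / (m : ℝ)) * ∑ i, φ x i) {x : M}
    (h : ∀ i, MDifferentiableAt 𝓘(ℝ, E) 𝓘(ℝ, ℝ) (fun x => φ x i) x) :
    MDifferentiableAt 𝓘(ℝ, E) 𝓘(ℝ, ℝ) Φ x ∧
      grad E Φ x = (m : ℝ)⁻¹ • ∑ i, grad E (fun x => φ x i) x := by
  have h1 : HasMFDerivAt 𝓘(ℝ, E) 𝓘(ℝ, ℝ) ((m : ℝ)⁻¹ • ∑ i, fun x => φ x i) x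
      ((m : ℝ)⁻¹ • ∑ i, mfderiv 𝓘(ℝ, E) 𝓘(ℝ, ℝ) (fun x => φ x i) x) :=
    (HasMFDerivAt.sum fun i _ => (h i).hasMFDerivAt).const_smul _
  have h2 : ((m : ℝ)⁻¹ • ∑ i, fun x => φ x i) = Φ := by
    ext y
    simp [hΦ y]
  rw [h2] at h1
  refine ⟨h1.mdifferentiableAt, ext_inner_right ℝ fun v => ?_⟩
  rw [inner_grad, h1.mfderiv, real_inner_smul_left, sum_inner]
  simp only [inner_grad]
  let D : Fin m → E →L[ℝ] ℝ := fun i => mfderiv 𝓘(ℝ, E) 𝓘(ℝ, ℝ) (fun x => φ x i) x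
  have h3 : ∀ v : E, ((m : ℝ)⁻¹ • ∑ i, D i) v = (m : ℝ)⁻¹ * ∑ i, D i v := by
    intro v
    simp
  exact h3 v

variable [IsContMDiffRiemannianBundle 𝓘(ℝ, E) ∞ E (fun x : M => TangentSpace 𝓘(ℝ, E) x)]
  [IsRiemannianManifold 𝓘(ℝ, E) M] {X : Set M} {geo : GeodesicMaps E X}

theorem GeodesicMaps.dist_γ {x y : M} (hx : x ∈ X) (hy : y ∈ X) {t : ℝ}
    (ht : t ∈ Icc (0 : ℝ) 1) : dist x (geo.γ x y t) = t * dist x y := by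
  have hc := geo.isMinGeodesic x hx y hy
  have h0 : (0 : ℝ) ∈ Icc (0 : ℝ) 1 := ⟨le_rfl, zero_le_one⟩
  rw [← (hc.restrict ht).norm_velocity_eq_dist h0,
    vel_restrict hc.smooth ht h0]
  have h1 := hc.norm_velocity_eq_dist (mapsTo_mul_Icc ht h0)
  simp only at h1 ⊢
  rw [norm_smul, h1, Real.norm_of_nonneg ht.1]

/-- Transport to `γ x y t` is defined along the chosen geodesic to that point. Uniqueness in `X`
says that this is the rescaled initial piece of `γ x y`, along which the velocity of `γ x y` is
parallel. -/
theorem GeodesicMaps.velocity_γ (hX : GeodesicallyConvex E X) {x y : M} (hx : x ∈ X) (hy : y ∈ X)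
    {t : ℝ} (ht : t ∈ Icc (0 : ℝ) 1) :
    vel (E := E) (geo.γ x y) t = geo.Γ x (geo.γ x y t) (geo.Log x y) := by
  have hc := geo.isMinGeodesic x hx y hy
  have hcX := geo.mapsTo x hx y hy
  have hct : geo.γ x y t ∈ X := hcX ht
  have hpar : IsParallel fun s => velocity (E := E) (geo.γ x y) (t * s) := by
    refine (IsParallel.restrict hc.smooth (v := fun t => vel (E := E) (geo.γ x y) t)
      hc.geodesic ht 1).congr fun s _ => ?_
    rw [one_smul]
    rfl
  have hproj : ∀ s ∈ Icc (0 : ℝ) 1, (velocity (E := E) (geo.γ x y) (t * s)).proj =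
      geo.γ x (geo.γ x y t) s :=
    (hX x hx _ hct).2 _ _ (hc.restrict ht) (fun s hs => hcX (mapsTo_mul_Icc ht hs))
      (geo.isMinGeodesic x hx _ hct) (geo.mapsTo x hx _ hct)
  have key := geo.eq_transport hx hct hpar hproj (u := geo.Log x y) (by
    rw [mul_zero]
    exact (geo.log_eq x hx y hy).symm)
  simp only [mul_one] at key
  exact TotalSpace.mk_inj.1 key

/-- The descent inequality along minimizing geodesics. -/
theorem LSmoothOn.descent (hX : GeodesicallyConvex E X) {L : ℝ} {f : M → ℝ}
    (hf : LSmoothOn geo L f) {x y : M} (hx : x ∈ X) (hy : y ∈ X) {t : ℝ}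
    (ht : t ∈ Icc (0 : ℝ) 1) :
    f (geo.γ x y t) ≤ f x + t * inner ℝ (grad E f x) (geo.Log x y) +
      L * dist x y ^ 2 * t ^ 2 / 2 := by
  have hc := geo.isMinGeodesic x hx y hy
  have hcX := geo.mapsTo x hx y hy
  have hderiv : ∀ s ∈ Icc (0 : ℝ) 1, HasDerivWithinAt (fun r => f (geo.γ x y r))
      (inner ℝ (grad E f (geo.γ x y s)) (vel (E := E) (geo.γ x y) s)) (Icc 0 1) s := by
    intro s hs
    have h1 : MDifferentiableWithinAt 𝓘(ℝ, ℝ) 𝓘(ℝ, E) (geo.γ x y) (Icc 0 1) s :=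
      (hc.smooth s hs).mdifferentiableWithinAt (by simp)
    have h2 := (hf.1 _ (hcX hs)).hasMFDerivAt.comp_hasMFDerivWithinAt s h1.hasMFDerivWithinAt
    rw [inner_grad]
    let A : E →L[ℝ] ℝ := mfderiv 𝓘(ℝ, E) 𝓘(ℝ, ℝ) f (geo.γ x y s)
    let B : ℝ →L[ℝ] E := mfderivWithin 𝓘(ℝ, ℝ) 𝓘(ℝ, E) (geo.γ x y) (Icc 0 1) s
    have h3 : HasFDerivWithinAt (fun r => f (geo.γ x y r)) (A.comp B) (Icc 0 1) s :=
      h2.hasFDerivWithinAt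
    exact h3.hasDerivWithinAt
  -- Since the velocity is `Γ (Log x y)` and `Γ` is isometric, the slope differs from the initial
  -- one only through `grad f - Γ grad f`, of norm at most `L s d(x, y)`. Integrating in `s` gives
  -- the quadratic term.
  have hbound : ∀ s ∈ Icc (0 : ℝ) 1,
      inner ℝ (grad E f (geo.γ x y s)) (vel (E := E) (geo.γ x y) s) ≤
        inner ℝ (grad E f x) (geo.Log x y) + L * dist x y ^ 2 * s := by
    intro s hs
    rw [geo.velocity_γ hX hx hy hs]
    have h1 := hf.2 x hx _ (hcX hs)
    rw [geo.dist_γ hx hy hs] at h1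
    have h2 := real_inner_le_norm (grad E f (geo.γ x y s) -
      geo.Γ x (geo.γ x y s) (grad E f x)) (geo.Γ x (geo.γ x y s) (geo.Log x y))
    rw [inner_sub_left, geo.inner_transport hx (hcX hs), geo.norm_transport hx (hcX hs),
      GeodesicMaps.norm_log hx hy] at h2
    have h3 := mul_le_mul_of_nonneg_right h1 (dist_nonneg (x := x) (y := y))
    nlinarith
  have hB : ∀ s : ℝ, HasDerivAt (fun r => f x + r * inner ℝ (grad E f x) (geo.Log x y) +
      L * dist x y ^ 2 * r ^ 2 / 2)
      (inner ℝ (grad E f x) (geo.Log x y) + L * dist x y ^ 2 * s) s := by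
    intro s
    have := (((hasDerivAt_id s).mul_const (inner ℝ (grad E f x) (geo.Log x y))).const_add
      (f x)).add ((((hasDerivAt_id s).pow 2).const_mul (L * dist x y ^ 2)).div_const 2)
    refine this.congr_deriv ?_
    simp
    ring
  refine image_le_of_deriv_right_le_deriv_boundary (a := 0) (b := 1)
    (fun s hs => (hderiv s hs).continuousWithinAt)
    (fun s hs => (hderiv s (Ico_subset_Icc_self hs)).mono_of_mem_nhdsWithin
      (Icc_mem_nhdsGE_of_mem hs)) (by simp [hc.source])
    (fun s _ => (hB s).continuousAt.continuousWithinAt)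
    (fun s _ => (hB s).hasDerivWithinAt) (fun s hs => hbound s (Ico_subset_Icc_self hs)) ht

end Descent

/-! ### Measurable vector fields through a countable choice of charts -/

theorem measurable_select {α β : Type*} [MeasurableSpace α] [MeasurableSpace β] {h : ℕ → α → β}
    (hm : ∀ n, Measurable (h n)) {i : α → ℕ} (hi : Measurable i) :
    Measurable fun a => h (i a) a :=
  (measurable_from_prod_countable_right (f := fun q : ℕ × α => h q.1 q.2) hm).comp
    (hi.prodMk measurable_id)

section MeasurableFields

variable {E : Type*} [NormedAddCommGroup E] [NormedSpace ℝ E] [FiniteDimensional ℝ E]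
  {M : Type*} [MetricSpace M] [ChartedSpace E M] [IsManifold 𝓘(ℝ, E) ∞ M]
  [SecondCountableTopology M] [Nonempty M]

variable (E M) in
theorem exists_chart_seq : ∃ p : ℕ → M, ∀ x, ∃ n, x ∈ (chartAt E (p n)).source := by
  obtain ⟨s, hs, hsu⟩ := TopologicalSpace.countable_cover_nhds
    (f := fun x : M => (chartAt E x).source)
    (fun x => (chartAt E x).open_source.mem_nhds (mem_chart_source E x))
  have hne : s.Nonempty := by
    by_contra h
    rw [not_nonempty_iff_eq_empty] at h
    rw [h] at hsu
    simp only [mem_empty_iff_false, iUnion_of_empty, iUnion_empty] at hsu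
    exact empty_ne_univ hsu
  obtain ⟨p, rfl⟩ := hs.exists_eq_range hne
  refine ⟨p, fun x => ?_⟩
  have hx : x ∈ ⋃ y ∈ range p, (chartAt E y).source := hsu ▸ mem_univ x
  simpa using hx

variable (E) in
/-- A sequence of points whose charts cover the manifold. -/
noncomputable def chartSeq : ℕ → M := (exists_chart_seq E M).choose

variable (E) in
open Classical in
/-- The index of the first chart of `chartSeq` that contains `x`. -/
noncomputable def chartIdx (x : M) : ℕ := Nat.find ((exists_chart_seq E M).choose_spec x)

variable (E) in
theorem mem_chartSeq_source (x : M) : x ∈ (chartAt E (chartSeq E (chartIdx E x) : M)).source := by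
  classical
  exact Nat.find_spec ((exists_chart_seq E M).choose_spec x)

/-- The coordinates of the tangent space at `x` given by the first chart that contains `x`. -/
noncomputable def fiberCoord (x : M) : TangentSpace 𝓘(ℝ, E) x ≃L[ℝ] E :=
  (trivializationAt E (TangentSpace 𝓘(ℝ, E)) (chartSeq E (chartIdx E x) : M)).continuousLinearEquivAt
    ℝ x (mem_chartSeq_source E x)

variable [MeasurableSpace M] [BorelSpace M] [MeasurableSpace E] [BorelSpace E]

instance : BorelSpace (TangentBundle 𝓘(ℝ, E) M) := ⟨rfl⟩

variable (E) in
theorem measurable_chartIdx : Measurable (chartIdx E : M → ℕ) := by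
  classical
  exact measurable_find _ fun n => (chartAt E (chartSeq E n : M)).open_source.measurableSet

theorem continuous_tangentBundle_proj :
    Continuous (fun V : TangentBundle 𝓘(ℝ, E) M => V.proj) :=
  FiberBundle.continuous_proj E (TangentSpace 𝓘(ℝ, E))

/-- Each trivialization is continuous on an open set; extended by zero it is Borel, and the chart
index is a measurable selection among countably many such maps. -/
theorem measurable_fiberCoord :
    Measurable fun V : TangentBundle 𝓘(ℝ, E) M => fiberCoord V.proj V.2 := by
  classical
  let h : ℕ → TangentBundle 𝓘(ℝ, E) M → E := fun n =>
    (trivializationAt E (TangentSpace 𝓘(ℝ, E)) (chartSeq E n : M)).source.piecewise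
      (fun V => (trivializationAt E (TangentSpace 𝓘(ℝ, E)) (chartSeq E n : M) V).2) fun _ => 0
  have hm : ∀ n, Measurable (h n) := fun n =>
    ContinuousOn.measurable_piecewise
      (continuous_snd.comp_continuousOn
        (trivializationAt E (TangentSpace 𝓘(ℝ, E)) (chartSeq E n : M)).continuousOn)
      continuousOn_const
      (trivializationAt E (TangentSpace 𝓘(ℝ, E)) (chartSeq E n : M)).open_source.measurableSet
  have h3 : (fun V : TangentBundle 𝓘(ℝ, E) M => fiberCoord V.proj V.2) =
      fun V => h (chartIdx E V.proj) V := by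
    ext V
    have hV : V ∈ (trivializationAt E (TangentSpace 𝓘(ℝ, E))
        (chartSeq E (chartIdx E V.proj) : M)).source := mem_chartSeq_source E V.proj
    simp only [h, Set.piecewise_eq_of_mem _ _ _ hV]
    exact Trivialization.continuousLinearEquivAt_apply' _ V hV
  rw [h3]
  exact measurable_select hm ((measurable_chartIdx E).comp
    continuous_tangentBundle_proj.measurable)

theorem measurable_fiberCoord_symm :
    Measurable fun q : M × E => (⟨q.1, (fiberCoord q.1).symm q.2⟩ : TangentBundle 𝓘(ℝ, E) M) := by
  classical
  let h : ℕ → M × E → TangentBundle 𝓘(ℝ, E) M := fun n =>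
    (trivializationAt E (TangentSpace 𝓘(ℝ, E)) (chartSeq E n : M)).target.piecewise
      (trivializationAt E (TangentSpace 𝓘(ℝ, E))
        (chartSeq E n : M)).toOpenPartialHomeomorph.symm fun q => zeroSection E _ q.1
  have hz : Continuous (zeroSection E (TangentSpace 𝓘(ℝ, E) : M → Type _)) :=
    (contMDiff_zeroSection (IB := 𝓘(ℝ, E)) (n := 0) ℝ (TangentSpace 𝓘(ℝ, E))).continuous
  have hm : ∀ n, Measurable (h n) := fun n =>
    ContinuousOn.measurable_piecewise
      (trivializationAt E (TangentSpace 𝓘(ℝ, E))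
        (chartSeq E n : M)).toOpenPartialHomeomorph.continuousOn_symm
      (hz.comp continuous_fst).continuousOn
      (trivializationAt E (TangentSpace 𝓘(ℝ, E)) (chartSeq E n : M)).open_target.measurableSet
  have h3 : (fun q : M × E => (⟨q.1, (fiberCoord q.1).symm q.2⟩ : TangentBundle 𝓘(ℝ, E) M)) =
      fun q => h (chartIdx E q.1) q := by
    ext1 q
    have hV : q ∈ (trivializationAt E (TangentSpace 𝓘(ℝ, E))
        (chartSeq E (chartIdx E q.1) : M)).target := by
      rw [Trivialization.mem_target]
      exact mem_chartSeq_source E q.1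
    simp only [h, Set.piecewise_eq_of_mem _ _ _ hV]
    exact (Trivialization.symm_apply_eq_mk_continuousLinearEquivAt_symm _ q.1
      (mem_chartSeq_source E q.1) q.2).symm
  rw [h3]
  exact measurable_select hm ((measurable_chartIdx E).comp measurable_fst)

variable {α : Type*} [MeasurableSpace α]

/-- Reduces measurability in the tangent bundle to that of the base point and of a vector in the
fixed space `E`; as `fiberCoord` is linear on fibres, sums and multiples of fields become routine.
-/
theorem measurable_field_iff {x : α → M} {v : ∀ a, TangentSpace 𝓘(ℝ, E) (x a)} :
    Measurable (fun a => (⟨x a, v a⟩ : TangentBundle 𝓘(ℝ, E) M)) ↔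
      Measurable x ∧ Measurable fun a => fiberCoord (x a) (v a) := by
  constructor
  · intro h
    have h1 := (continuous_tangentBundle_proj (E := E) (M := M)).measurable.comp h
    have h2 := (measurable_fiberCoord (E := E) (M := M)).comp h
    simp only [Function.comp_def] at h1 h2
    exact ⟨h1, h2⟩
  · rintro ⟨h1, h2⟩
    have := measurable_fiberCoord_symm.comp (h1.prodMk h2)
    simp only [Function.comp_def, ContinuousLinearEquiv.symm_apply_apply] at this
    exact this

section Closure

variable {x : α → M} {v w : ∀ a, TangentSpace 𝓘(ℝ, E) (x a)}

theorem measurable_field_sub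
    (hv : Measurable fun a => (⟨x a, v a⟩ : TangentBundle 𝓘(ℝ, E) M))
    (hw : Measurable fun a => (⟨x a, w a⟩ : TangentBundle 𝓘(ℝ, E) M)) :
    Measurable fun a => (⟨x a, v a - w a⟩ : TangentBundle 𝓘(ℝ, E) M) := by
  rw [measurable_field_iff] at hv hw ⊢
  simp only [map_sub]
  exact ⟨hv.1, hv.2.sub hw.2⟩

theorem measurable_field_smul (hv : Measurable fun a => (⟨x a, v a⟩ : TangentBundle 𝓘(ℝ, E) M))
    (r : ℝ) : Measurable fun a => (⟨x a, r • v a⟩ : TangentBundle 𝓘(ℝ, E) M) := by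
  rw [measurable_field_iff] at hv ⊢
  simp only [map_smul]
  exact ⟨hv.1, hv.2.const_smul r⟩

theorem measurable_field_sum {ι : Type*} (s : Finset ι) (hx : Measurable x)
    {v : ι → ∀ a, TangentSpace 𝓘(ℝ, E) (x a)}
    (hv : ∀ i ∈ s, Measurable fun a => (⟨x a, v i a⟩ : TangentBundle 𝓘(ℝ, E) M)) :
    Measurable fun a => (⟨x a, ∑ i ∈ s, v i a⟩ : TangentBundle 𝓘(ℝ, E) M) := by
  rw [measurable_field_iff]
  simp only [map_sum]
  exact ⟨hx, Finset.measurable_fun_sum s fun i hi => (measurable_field_iff.1 (hv i hi)).2⟩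

theorem measurable_field_norm [RiemannianBundle (fun x : M => TangentSpace 𝓘(ℝ, E) x)]
    [IsContMDiffRiemannianBundle 𝓘(ℝ, E) ∞ E (fun x : M => TangentSpace 𝓘(ℝ, E) x)]
    (hv : Measurable fun a => (⟨x a, v a⟩ : TangentBundle 𝓘(ℝ, E) M)) :
    Measurable fun a => ‖v a‖ := by
  have hc : IsContinuousRiemannianBundle E (fun x : M => TangentSpace 𝓘(ℝ, E) x) := by
    obtain ⟨g, hg, hg'⟩ := IsContMDiffRiemannianBundle.exists_contMDiff (IB := 𝓘(ℝ, E)) (n := ∞)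
      (F := E) (E := fun x : M => TangentSpace 𝓘(ℝ, E) x)
    exact ⟨g, hg.continuous, hg'⟩
  have h1 : Continuous fun V : TangentBundle 𝓘(ℝ, E) M => inner ℝ V.2 V.2 :=
    Continuous.inner_bundle (F := E) (E := fun x : M => TangentSpace 𝓘(ℝ, E) x)
      (b := fun V : TangentBundle 𝓘(ℝ, E) M => V.proj)
      (v := fun V => V.2) (w := fun V => V.2) continuous_id continuous_id
  have h2 : (fun a => ‖v a‖) = (fun V : TangentBundle 𝓘(ℝ, E) M => √(inner ℝ V.2 V.2)) ∘
      fun a => (⟨x a, v a⟩ : TangentBundle 𝓘(ℝ, E) M) := by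
    ext a
    exact norm_eq_sqrt_real_inner (v a)
  rw [h2]
  exact (Real.continuous_sqrt.comp h1).measurable.comp hv

end Closure

end MeasurableFields

/-! ### Variance of averages of independent samples -/

section Variance

variable {H : Type*} [NormedAddCommGroup H] [InnerProductSpace ℝ H] [CompleteSpace H]
  {Ξ : Type*} [MeasurableSpace Ξ] {P : Measure Ξ} [IsProbabilityMeasure P]
  {Ω : Type*} [MeasurableSpace Ω] {μ : Measure Ω} [IsProbabilityMeasure μ]
  {ξ : ℕ → Ω → Ξ} {h : Ξ → H} {R : ℝ}

/-- Independent centred vectors are orthogonal in mean, so second moments add up; induction on `b`.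
-/
theorem integral_norm_sum_sq_le (hξ : ∀ i, Measurable (ξ i)) (hlaw : ∀ i, μ.map (ξ i) = P)
    (hind : iIndepFun ξ μ) (hh : AEStronglyMeasurable h P) (hR : ∀ᵐ s ∂P, ‖h s‖ ≤ R)
    (hmean : ∫ s, h s ∂P = 0) (b : ℕ) :
    Integrable (fun w => ∑ i ∈ Finset.range b, h (ξ i w)) μ ∧
    ∫ w, ∑ i ∈ Finset.range b, h (ξ i w) ∂μ = 0 ∧
    Integrable (fun w => ‖∑ i ∈ Finset.range b, h (ξ i w)‖ ^ 2) μ ∧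
    ∫ w, ‖∑ i ∈ Finset.range b, h (ξ i w)‖ ^ 2 ∂μ ≤ b * R ^ 2 := by
  have hP : Integrable h P := Integrable.of_bound hh R hR
  have hbd : ∀ᵐ w ∂μ, ∀ i, ‖h (ξ i w)‖ ≤ R := by
    rw [ae_all_iff]
    intro i
    have := hR
    rw [← hlaw i] at this
    exact ae_of_ae_map (hξ i).aemeasurable this
  have hsm : ∀ i, AEStronglyMeasurable (fun w => h (ξ i w)) μ := fun i => by
    have := hh
    rw [← hlaw i] at this
    exact this.comp_measurable (hξ i)
  have hint : ∀ i, Integrable (fun w => h (ξ i w)) μ := fun i =>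
    Integrable.of_bound (hsm i) R (hbd.mono fun w hw => hw i)
  have hmean' : ∀ i, ∫ w, h (ξ i w) ∂μ = 0 := fun i => by
    have h1 := integral_map (hξ i).aemeasurable (f := h) (by rw [hlaw i]; exact hh)
    rw [← h1, hlaw i, hmean]
  have hinner_int : ∀ i j, Integrable (fun w => inner ℝ (h (ξ i w)) (h (ξ j w))) μ := fun i j =>
    Integrable.of_bound ((hsm i).inner (hsm j)) (R * R) (hbd.mono fun w hw =>
      (norm_inner_le_norm _ _).trans
        (mul_le_mul (hw i) (hw j) (norm_nonneg _) ((norm_nonneg _).trans (hw i))))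
  have horth : ∀ i j, i ≠ j → ∫ w, inner ℝ (h (ξ i w)) (h (ξ j w)) ∂μ = 0 := by
    intro i j hij
    have := (hind.indepFun hij).integral_bilin_comp_comp (hξ i).aemeasurable (hξ j).aemeasurable
      (f := h) (g := h) (by rw [hlaw i]; exact hP) (by rw [hlaw j]; exact hP) (innerSL ℝ)
    refine this.trans ?_
    rw [hmean', map_zero]
    rfl
  have hsq : ∀ i, ∫ w, ‖h (ξ i w)‖ ^ 2 ∂μ ≤ R ^ 2 := by
    intro i
    have h2 : ∫ w, ‖h (ξ i w)‖ ^ 2 ∂μ ≤ ∫ _, R ^ 2 ∂μ := by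
      refine integral_mono_ae ?_ (integrable_const _) (hbd.mono fun w hw => ?_)
      · simpa using hinner_int i i
      · exact pow_le_pow_left₀ (norm_nonneg _) (hw i) 2
    simpa using h2
  refine ⟨integrable_finsetSum _ fun i _ => hint i, ?_, ?_⟩
  · rw [integral_finsetSum _ fun i _ => hint i]
    exact Finset.sum_eq_zero fun i _ => hmean' i
  induction b with
  | zero => simp
  | succ b ih =>
    have e : ∀ w, ‖∑ i ∈ Finset.range (b + 1), h (ξ i w)‖ ^ 2 =
        ‖∑ i ∈ Finset.range b, h (ξ i w)‖ ^ 2 +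
        2 * ∑ i ∈ Finset.range b, inner ℝ (h (ξ i w)) (h (ξ b w)) + ‖h (ξ b w)‖ ^ 2 := by
      intro w
      rw [Finset.sum_range_succ, norm_add_sq_real, sum_inner]
    have i1 : Integrable (fun w => ∑ i ∈ Finset.range b, inner ℝ (h (ξ i w)) (h (ξ b w))) μ :=
      integrable_finsetSum _ fun i _ => hinner_int i b
    have i2 : Integrable (fun w => ‖h (ξ b w)‖ ^ 2) μ := by simpa using hinner_int b b
    simp only [e]
    have i3 : Integrable (fun w => ‖∑ i ∈ Finset.range b, h (ξ i w)‖ ^ 2 +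
        2 * ∑ i ∈ Finset.range b, inner ℝ (h (ξ i w)) (h (ξ b w))) μ := ih.1.add (i1.const_mul 2)
    refine ⟨i3.add i2, ?_⟩
    rw [integral_add i3 i2, integral_add ih.1 (i1.const_mul 2), integral_const_mul,
      integral_finsetSum _ fun i _ => hinner_int i b, Finset.sum_eq_zero fun i hi =>
        horth i b (Finset.mem_range.1 hi).ne]
    push_cast
    linarith [ih.2, hsq b]

/-- The mean square deviation of the average of `b` independent samples, shifted by `u`. -/
theorem lintegral_average_le (hξ : ∀ i, Measurable (ξ i)) (hlaw : ∀ i, μ.map (ξ i) = P)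
    (hind : iIndepFun ξ μ) (hh : AEStronglyMeasurable h P) (hR : ∀ᵐ s ∂P, ‖h s‖ ≤ R)
    {b : ℕ} {s : ℝ} (hs : 0 ≤ s) (hb : 4 * R ^ 2 ≤ b * s) (u : H) :
    ∫⁻ w, ENNReal.ofReal (‖(b : ℝ)⁻¹ • ∑ i ∈ Finset.range b, h (ξ i w) - ∫ s, h s ∂P + u‖ ^ 2) ∂μ
      ≤ ENNReal.ofReal (‖u‖ ^ 2 + s) := by
  have hP : Integrable h P := Integrable.of_bound hh R hR
  have hm : ‖∫ s, h s ∂P‖ ≤ R := by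
    have := norm_integral_le_of_norm_le_const hR
    simpa using this
  -- An empty batch is possible (when two consecutive iterates coincide). Then `hb` forces `R = 0`,
  -- so the mean is zero and the empty average is exact.
  rcases Nat.eq_zero_or_pos b with rfl | hb0
  · have hR0 : R = 0 := by
      have : R ^ 2 ≤ 0 := by simp at hb; linarith
      nlinarith [sq_nonneg R, pow_eq_zero_iff (two_ne_zero) |>.1 (le_antisymm this (sq_nonneg R))]
    rw [hR0] at hm
    have hm0 : ∫ s, h s ∂P = 0 := norm_le_zero_iff.1 hm
    simp only [hm0]
    simp only [Finset.range_zero, Finset.sum_empty, smul_zero, sub_zero, zero_add,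
      lintegral_const, measure_univ, mul_one]
    exact ENNReal.ofReal_le_ofReal (by linarith)
  · set m := ∫ s, h s ∂P with hmdef
    have hb' : (0 : ℝ) < b := by exact_mod_cast hb0
    -- Centring at most doubles the bound on the samples; this is the origin of the factor `4` in
    -- `hb`.
    obtain ⟨c1, c2, c3, c4⟩ := integral_norm_sum_sq_le (h := fun s => h s - m) (R := 2 * R)
      hξ hlaw hind (hh.sub aestronglyMeasurable_const)
      (hR.mono fun s hs => (norm_sub_le _ _).trans (by linarith)) (by
        rw [integral_sub hP (integrable_const _)]
        simp [hmdef]) b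
    set S : Ω → H := fun w => ∑ i ∈ Finset.range b, (h (ξ i w) - m) with hS
    have e1 : ∀ w, ‖(b : ℝ)⁻¹ • ∑ i ∈ Finset.range b, h (ξ i w) - m + u‖ ^ 2 =
        (b : ℝ)⁻¹ ^ 2 * ‖S w‖ ^ 2 + 2 * (b : ℝ)⁻¹ * inner ℝ (S w) u + ‖u‖ ^ 2 := by
      intro w
      have : (b : ℝ)⁻¹ • ∑ i ∈ Finset.range b, h (ξ i w) - m = (b : ℝ)⁻¹ • S w := by
        simp only [hS, Finset.sum_sub_distrib, Finset.sum_const, Finset.card_range, smul_sub]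
        rw [← Nat.cast_smul_eq_nsmul ℝ, smul_smul, inv_mul_cancel₀ hb'.ne', one_smul]
      rw [this, norm_add_sq_real, norm_smul, real_inner_smul_left, mul_pow]
      simp
      ring
    simp only [e1]
    have i1 : Integrable (fun w => (b : ℝ)⁻¹ ^ 2 * ‖S w‖ ^ 2) μ := c3.const_mul _
    have i2 : Integrable (fun w => 2 * (b : ℝ)⁻¹ * inner ℝ (S w) u) μ :=
      (c1.inner_const u).const_mul _
    have i3 : Integrable (fun _ : Ω => ‖u‖ ^ 2) μ := integrable_const _
    have i12 : Integrable (fun w => (b : ℝ)⁻¹ ^ 2 * ‖S w‖ ^ 2 +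
      2 * (b : ℝ)⁻¹ * inner ℝ (S w) u) μ := i1.add i2
    have i123 : Integrable (fun w => (b : ℝ)⁻¹ ^ 2 * ‖S w‖ ^ 2 +
      2 * (b : ℝ)⁻¹ * inner ℝ (S w) u + ‖u‖ ^ 2) μ := i12.add i3
    rw [← ofReal_integral_eq_lintegral_ofReal i123
      (Filter.Eventually.of_forall fun w => by
        simp only [Pi.zero_apply]
        rw [← e1 w]
        positivity)]
    refine ENNReal.ofReal_le_ofReal ?_
    rw [integral_add i12 i3, integral_add i1 i2, integral_const_mul, integral_const_mul]
    have e2 : ∫ w, inner ℝ (S w) u ∂μ = 0 := by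
      have := integral_inner (𝕜 := ℝ) c1 u
      simp only [c2, inner_zero_right] at this
      simp only [real_inner_comm u] at this ⊢
      exact this
    rw [e2]
    have e3 : (b : ℝ)⁻¹ ^ 2 * ∫ w, ‖S w‖ ^ 2 ∂μ ≤ s := by
      calc (b : ℝ)⁻¹ ^ 2 * ∫ w, ‖S w‖ ^ 2 ∂μ ≤ (b : ℝ)⁻¹ ^ 2 * (b * (b * s)) := by
            gcongr
            refine c4.trans ?_
            gcongr
            linarith
        _ = s := by field_simp
    simp only [mul_zero, add_zero, integral_const, probReal_univ, smul_eq_mul, one_mul]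
    linarith

end Variance

/-! ### Mean square error of the gradient estimates along a run -/

/-- Freezing the past: by independence the joint law is a product, and Tonelli applies. It turns
variance bounds at fixed points into bounds at random iterates. -/
theorem lintegral_indep {Ω α β : Type*} {m : MeasurableSpace Ω} [mΩ : MeasurableSpace Ω]
    {μ : Measure Ω}
    [IsProbabilityMeasure μ] [mα : MeasurableSpace α] [mβ : MeasurableSpace β]
    (hm : m ≤ mΩ) {Y : Ω → α} (hY : Measurable[m] Y) {S : Ω → β}
    (hS : Measurable S) (hind : Indep (MeasurableSpace.comap S mβ) m μ)
    {F : α × β → ENNReal} (hF : Measurable F) :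
    ∫⁻ w, F (Y w, S w) ∂μ = ∫⁻ w, ∫⁻ w', F (Y w, S w') ∂μ ∂μ := by
  have hY' : Measurable Y := hY.mono hm le_rfl
  have hYS : IndepFun Y S μ := by
    rw [IndepFun_iff_Indep]
    exact indep_of_indep_of_le_left hind.symm hY.comap_le
  have h1 := hYS.map_prod_eq_prod_map_map hY'.aemeasurable hS.aemeasurable
  have := Measure.isProbabilityMeasure_map (μ := μ) hS.aemeasurable
  rw [← lintegral_map (f := F) (g := fun w => (Y w, S w)) hF (hY'.prodMk hS), h1,
    lintegral_prod _ hF.aemeasurable, lintegral_map hF.lintegral_prod_right' hY']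
  congr with w
  exact lintegral_map (hF.comp measurable_prodMk_left) hS

theorem measurable_sequence {α Ξ : Type*} [mα : MeasurableSpace α] [MeasurableSpace Ξ]
    {f : ℕ → α → Ξ} (hf : ∀ i, Measurable (f i)) : Measurable fun a i => f i a :=
  measurable_pi_lambda _ hf

theorem measurable_mul_dist_div {α M : Type*} [mα : MeasurableSpace α] [MetricSpace M]
    [SecondCountableTopology M] [MeasurableSpace M] [BorelSpace M] {x y : α → M}
    (hx : Measurable x) (hy : Measurable y) (c d : ℝ) :
    Measurable fun a => c * dist (x a) (y a) / d :=
  ((hx.dist hy).const_mul _).div_const _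

section Run

variable {E : Type*} [NormedAddCommGroup E] [NormedSpace ℝ E] [FiniteDimensional ℝ E]
  {M : Type*} [MetricSpace M] [SecondCountableTopology M] [ChartedSpace E M]
  [IsManifold 𝓘(ℝ, E) ∞ M]
  [RiemannianBundle (fun x : M => TangentSpace 𝓘(ℝ, E) x)]
  [IsContMDiffRiemannianBundle 𝓘(ℝ, E) ∞ E (fun x : M => TangentSpace 𝓘(ℝ, E) x)]
  [IsRiemannianManifold 𝓘(ℝ, E) M]
  [MeasurableSpace M] [BorelSpace M]
  {X : Set M} {geo : GeodesicMaps E X}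
  {Ξ : Type*} [MeasurableSpace Ξ] {P : Measure Ξ}
  {S₁ : (ℕ → Ξ) → ∀ x : M, TangentSpace 𝓘(ℝ, E) x}
  {S₂ : ℝ → (ℕ → Ξ) → ∀ x : M, TangentSpace 𝓘(ℝ, E) x}

/-- Joint measurability of an epoch estimator on `X`. -/
def MeasurableEstimator (X : Set M) (S₁ : (ℕ → Ξ) → ∀ x : M, TangentSpace 𝓘(ℝ, E) x) : Prop :=
  Measurable fun q : (ℕ → Ξ) × X => (⟨q.2, S₁ q.1 q.2⟩ : TangentBundle 𝓘(ℝ, E) M)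

/-- Joint measurability of an inner estimator on `X`, including the requested batch size. -/
def MeasurableSizedEstimator (X : Set M)
    (S₂ : ℝ → (ℕ → Ξ) → ∀ x : M, TangentSpace 𝓘(ℝ, E) x) : Prop :=
  Measurable fun q : ℝ × (ℕ → Ξ) × X => (⟨q.2.2, S₂ q.1 q.2.1 q.2.2⟩ : TangentBundle 𝓘(ℝ, E) M)

theorem measurable_inner_step [Nonempty M] (hΓ : MeasurableTransport geo)
    (hS₂ : MeasurableSizedEstimator X S₂) {α : Type*} [mα : MeasurableSpace α]
    {x y : α → M} {g : ∀ a, TangentSpace 𝓘(ℝ, E) (x a)} {r : α → ℝ} {s : α → ℕ → Ξ}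
    (hxX : ∀ a, x a ∈ X) (hyX : ∀ a, y a ∈ X) (hy : Measurable y) (hr : Measurable r)
    (hs : Measurable s) (hg : Measurable fun a => (⟨x a, g a⟩ : TangentBundle 𝓘(ℝ, E) M)) :
    Measurable fun a => (⟨y a, S₂ (r a) (s a) (y a) -
      geo.Γ (x a) (y a) (S₂ (r a) (s a) (x a) - g a)⟩ : TangentBundle 𝓘(ℝ, E) M) := by
  borelize E
  have hx : Measurable x := (continuous_tangentBundle_proj (E := E) (M := M)).measurable.comp hg
  have h1 : Measurable fun a => (⟨y a, S₂ (r a) (s a) (y a)⟩ : TangentBundle 𝓘(ℝ, E) M) :=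
    hS₂.comp (hr.prodMk (hs.prodMk (hy.subtype_mk (h := hyX))))
  have h2 : Measurable fun a => (⟨x a, S₂ (r a) (s a) (x a)⟩ : TangentBundle 𝓘(ℝ, E) M) :=
    hS₂.comp (hr.prodMk (hs.prodMk (hx.subtype_mk (h := hxX))))
  have h3 := measurable_field_sub h2 hg
  have h4 : Measurable fun a => (⟨y a, geo.Γ (x a) (y a) (S₂ (r a) (s a) (x a) - g a)⟩ :
      TangentBundle 𝓘(ℝ, E) M) :=
    hΓ.comp ((h3.prodMk hy).subtype_mk (h := fun a => ⟨hxX a, hyX a⟩))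
  exact measurable_field_sub h1 h4

variable {L η ε : ℝ} {n K : ℕ} {Ω : Type*} [mΩ : MeasurableSpace Ω] {μ : Measure Ω}
  [IsProbabilityMeasure μ] {ℱ : Filtration ℕ mΩ}
  {ξ : ℕ → ℕ → Ω → Ξ} {x : ℕ → Ω → M} {g : ∀ (k : ℕ) (w : Ω), TangentSpace 𝓘(ℝ, E) (x k w)}
  {z : ℕ → Ω → M} {out : Ω → Fin K}

theorem IsRun.mem (run : IsRun geo P S₁ S₂ L η ε n K μ ℱ ξ x g z out) (hη : η ∈ Icc (0 : ℝ) 1)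
    {k : ℕ} (hk : k ≤ K) (w : Ω) : x k w ∈ X := by
  induction k with
  | zero => exact run.init_mem w
  | succ k ih =>
    rw [run.step k hk w]
    exact geo.mapsTo _ (ih (Nat.le_of_succ_le hk)) _ (run.oracle_mem k hk w) hη

theorem IsRun.measurable_samples (run : IsRun geo P S₁ S₂ L η ε n K μ ℱ ξ x g z out) {k : ℕ}
    (hk : k < K) : Measurable[ℱ (k + 1)] fun w i => ξ k i w :=
  measurable_sequence (mα := ℱ (k + 1)) fun i => run.sample_measurable k hk i

theorem IsRun.measurable_g [Nonempty M] (run : IsRun geo P S₁ S₂ L η ε n K μ ℱ ξ x g z out)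
    (hη : η ∈ Icc (0 : ℝ) 1) (hΓ : MeasurableTransport geo) (hS₁ : MeasurableEstimator X S₁)
    (hS₂ : MeasurableSizedEstimator X S₂) {k : ℕ} (hk : k < K) :
    Measurable[ℱ (k + 1)] fun w => (⟨x k w, g k w⟩ : TangentBundle 𝓘(ℝ, E) M) := by
  have hepoch : ∀ k < K, k % n = 0 →
      Measurable[ℱ (k + 1)] fun w => (⟨x k w, g k w⟩ : TangentBundle 𝓘(ℝ, E) M) := by
    intro k hk hkn
    simp only [run.grad_epoch k hk hkn]
    have h1 : Measurable[ℱ (k + 1)] (x k) :=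
      (run.adapted k hk.le).mono (ℱ.mono (Nat.le_succ k)) le_rfl
    exact Measurable.comp hS₁ ((run.measurable_samples hk).prodMk
      (h1.subtype_mk (h := run.mem hη hk.le)))
  induction k with
  | zero => exact hepoch 0 hk (Nat.zero_mod n)
  | succ k ih =>
    by_cases hkn : (k + 1) % n = 0
    · exact hepoch _ hk hkn
    · simp only [run.grad_inner k hk hkn]
      have hk' : k < K := Nat.lt_of_succ_lt hk
      have hle : ℱ (k + 1) ≤ ℱ (k + 2) := ℱ.mono (Nat.le_succ _)
      have h1 : Measurable[ℱ (k + 2)] (x (k + 1)) := (run.adapted (k + 1) hk.le).mono hle le_rfl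
      have h0 : Measurable[ℱ (k + 2)] (x k) :=
        (run.adapted k hk'.le).mono (ℱ.mono (by lia)) le_rfl
      have hr : Measurable[ℱ (k + 2)] fun w =>
          2 * n * L ^ 2 * ‖geo.Log (x k w) (x (k + 1) w)‖ / ε ^ 2 := by
        simp only [GeodesicMaps.norm_log (run.mem hη hk'.le _) (run.mem hη hk.le _)]
        exact measurable_mul_dist_div (mα := ℱ (k + 2)) h0 h1 _ _
      exact measurable_inner_step (mα := ℱ (k + 2)) hΓ hS₂ (run.mem hη hk'.le)
        (run.mem hη hk.le) h1 hr (run.measurable_samples hk) ((ih hk').mono hle le_rfl)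

/-- The mean square error of the gradient estimate in iteration `k`. -/
noncomputable def meanSqError (μ : Measure Ω) (Φ : M → ℝ) (x : ℕ → Ω → M)
    (g : ∀ (k : ℕ) (w : Ω), TangentSpace 𝓘(ℝ, E) (x k w)) (k : ℕ) : ENNReal :=
  ∫⁻ w, ENNReal.ofReal (‖g k w - grad E Φ (x k w)‖ ^ 2) ∂μ

variable (P μ) in
/-- An i.i.d. sequence of samples with law `P`. -/
structure IsSample (ζ : ℕ → Ω → Ξ) : Prop where
  measurable : ∀ i, Measurable (ζ i)
  law : ∀ i, μ.map (ζ i) = P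
  iIndep : iIndepFun ζ μ

theorem IsRun.isSample (run : IsRun geo P S₁ S₂ L η ε n K μ ℱ ξ x g z out) {k : ℕ}
    (hk : k < K) : IsSample P μ (ξ k) :=
  ⟨fun i => (run.sample_measurable k hk i).mono (ℱ.le _) le_rfl, run.sample_law k hk,
    run.sample_iIndep k hk⟩

theorem IsRun.meanSqError_epoch [Nonempty M]
    (run : IsRun geo P S₁ S₂ L η ε n K μ ℱ ξ x g z out)
    (hη : η ∈ Icc (0 : ℝ) 1) (hS₁ : MeasurableEstimator X S₁) {Φ : M → ℝ}
    (hG : Measurable fun x : X => (⟨x, grad E Φ x⟩ : TangentBundle 𝓘(ℝ, E) M)) {c₁ : ENNReal}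
    (hV₁ : ∀ ζ : ℕ → Ω → Ξ, IsSample P μ ζ → ∀ x ∈ X,
      ∫⁻ w, ENNReal.ofReal (‖S₁ (fun i => ζ i w) x - grad E Φ x‖ ^ 2) ∂μ ≤ c₁)
    {k : ℕ} (hk : k < K) (hkn : k % n = 0) : meanSqError μ Φ x g k ≤ c₁ := by
  borelize E
  have hF : Measurable fun q : X × (ℕ → Ξ) =>
      ENNReal.ofReal (‖S₁ q.2 q.1 - grad E Φ q.1‖ ^ 2) := by
    have h1 : Measurable fun q : X × (ℕ → Ξ) =>
        (⟨q.1, S₁ q.2 q.1⟩ : TangentBundle 𝓘(ℝ, E) M) :=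
      Measurable.comp hS₁ measurable_swap
    exact ((measurable_field_norm (measurable_field_sub h1
      (hG.comp measurable_fst))).pow_const 2).ennreal_ofReal
  have key := lintegral_indep (ℱ.le k) ((run.adapted k hk.le).subtype_mk (h := run.mem hη hk.le))
    ((run.measurable_samples hk).mono (ℱ.le _) le_rfl) (run.sample_indep_past k hk) hF
  rw [meanSqError]
  simp only [run.grad_epoch k hk hkn]
  refine key.trans_le ?_
  calc _ ≤ ∫⁻ _, c₁ ∂μ := lintegral_mono fun w =>
        hV₁ (ξ k) (run.isSample hk) (x k w) (run.mem hη hk.le w)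
    _ = c₁ := by simp

/-- The triple `(x_k, g_k, x_{k+1})` is known before iteration `k + 1` samples, and it determines
the requested batch size. Freezing it reduces the claim to `hV₂` with `u = g_k`. -/
theorem IsRun.meanSqError_succ [Nonempty M]
    (run : IsRun geo P S₁ S₂ L η ε n K μ ℱ ξ x g z out)
    (hη : η ∈ Icc (0 : ℝ) 1) (hΓ : MeasurableTransport geo) (hS₁ : MeasurableEstimator X S₁)
    (hS₂ : MeasurableSizedEstimator X S₂) {Φ : M → ℝ}
    (hG : Measurable fun x : X => (⟨x, grad E Φ x⟩ : TangentBundle 𝓘(ℝ, E) M)) {c₂ : ENNReal}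
    (hV₂ : ∀ ζ : ℕ → Ω → Ξ, IsSample P μ ζ → ∀ x ∈ X, ∀ y ∈ X, ∀ u : TangentSpace 𝓘(ℝ, E) x,
      ∫⁻ w, ENNReal.ofReal (‖S₂ (2 * n * L ^ 2 * dist x y / ε ^ 2) (fun i => ζ i w) y -
        geo.Γ x y (S₂ (2 * n * L ^ 2 * dist x y / ε ^ 2) (fun i => ζ i w) x - u) -
          grad E Φ y‖ ^ 2) ∂μ ≤ ENNReal.ofReal (‖u - grad E Φ x‖ ^ 2) + c₂)
    {k : ℕ} (hk : k + 1 < K) (hkn : (k + 1) % n ≠ 0) :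
    meanSqError μ Φ x g (k + 1) ≤ meanSqError μ Φ x g k + c₂ := by
  borelize E
  have hk' : k < K := Nat.lt_of_succ_lt hk
  let Q := {q : TangentBundle 𝓘(ℝ, E) M × M // q.1.proj ∈ X ∧ q.2 ∈ X}
  have hp : Measurable fun q : Q × (ℕ → Ξ) => q.1.1.1 :=
    measurable_fst.comp (measurable_subtype_coe.comp measurable_fst)
  have hx : Measurable fun q : Q × (ℕ → Ξ) => q.1.1.1.proj :=
    (continuous_tangentBundle_proj (E := E) (M := M)).measurable.comp hp
  have hy : Measurable fun q : Q × (ℕ → Ξ) => q.1.1.2 :=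
    measurable_snd.comp (measurable_subtype_coe.comp measurable_fst)
  have hF : Measurable fun q : Q × (ℕ → Ξ) => ENNReal.ofReal
      (‖S₂ (2 * n * L ^ 2 * dist q.1.1.1.proj q.1.1.2 / ε ^ 2) q.2 q.1.1.2 -
        geo.Γ q.1.1.1.proj q.1.1.2 (S₂ (2 * n * L ^ 2 * dist q.1.1.1.proj q.1.1.2 / ε ^ 2) q.2
          q.1.1.1.proj - q.1.1.1.snd) - grad E Φ q.1.1.2‖ ^ 2) := by
    have h1 := measurable_inner_step hΓ hS₂ (fun q : Q × (ℕ → Ξ) => q.1.2.1) (fun q => q.1.2.2)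
      hy (measurable_mul_dist_div hx hy (2 * n * L ^ 2) (ε ^ 2))
      measurable_snd hp
    have h2 : Measurable fun q : Q × (ℕ → Ξ) =>
        (⟨q.1.1.2, grad E Φ q.1.1.2⟩ : TangentBundle 𝓘(ℝ, E) M) :=
      hG.comp (hy.subtype_mk (h := fun q => q.1.2.2))
    exact ((measurable_field_norm (measurable_field_sub h1 h2)).pow_const 2).ennreal_ofReal
  have hY : Measurable[ℱ (k + 1)] fun w => (⟨(⟨x k w, g k w⟩, x (k + 1) w),
      run.mem hη hk'.le w, run.mem hη hk.le w⟩ : Q) :=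
    ((run.measurable_g hη hΓ hS₁ hS₂ hk').prodMk (run.adapted (k + 1) hk.le)).subtype_mk
  have key := lintegral_indep (ℱ.le (k + 1)) hY
    ((run.measurable_samples hk).mono (ℱ.le _) le_rfl) (run.sample_indep_past (k + 1) hk) hF
  rw [meanSqError]
  simp only [run.grad_inner k hk hkn,
    GeodesicMaps.norm_log (run.mem hη hk'.le _) (run.mem hη hk.le _)]
  refine key.trans_le ?_
  calc _ ≤ ∫⁻ w, (ENNReal.ofReal (‖g k w - grad E Φ (x k w)‖ ^ 2) + c₂) ∂μ :=
        lintegral_mono fun w => hV₂ (ξ (k + 1)) (run.isSample hk) (x k w) (run.mem hη hk'.le w)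
          (x (k + 1) w) (run.mem hη hk.le w) (g k w)
    _ = meanSqError μ Φ x g k + c₂ := by
      rw [lintegral_add_right _ measurable_const]
      simp [meanSqError]

/-- Induction on `k` with the sharper count `k % n` of inner steps since the epoch began; a new
epoch resets the accumulated error. -/
theorem IsRun.meanSqError_le [Nonempty M]
    (run : IsRun geo P S₁ S₂ L η ε n K μ ℱ ξ x g z out)
    (hη : η ∈ Icc (0 : ℝ) 1) (hn : 0 < n)
    (hΓ : MeasurableTransport geo) (hS₁ : MeasurableEstimator X S₁)
    (hS₂ : MeasurableSizedEstimator X S₂) {Φ : M → ℝ}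
    (hG : Measurable fun x : X => (⟨x, grad E Φ x⟩ : TangentBundle 𝓘(ℝ, E) M)) {c₁ c₂ : ENNReal}
    (hV₁ : ∀ ζ : ℕ → Ω → Ξ, IsSample P μ ζ → ∀ x ∈ X,
      ∫⁻ w, ENNReal.ofReal (‖S₁ (fun i => ζ i w) x - grad E Φ x‖ ^ 2) ∂μ ≤ c₁)
    (hV₂ : ∀ ζ : ℕ → Ω → Ξ, IsSample P μ ζ → ∀ x ∈ X, ∀ y ∈ X, ∀ u : TangentSpace 𝓘(ℝ, E) x,
      ∫⁻ w, ENNReal.ofReal (‖S₂ (2 * n * L ^ 2 * dist x y / ε ^ 2) (fun i => ζ i w) y -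
        geo.Γ x y (S₂ (2 * n * L ^ 2 * dist x y / ε ^ 2) (fun i => ζ i w) x - u) -
          grad E Φ y‖ ^ 2) ∂μ ≤ ENNReal.ofReal (‖u - grad E Φ x‖ ^ 2) + c₂)
    {k : ℕ} (hk : k < K) : meanSqError μ Φ x g k ≤ c₁ + n * c₂ := by
  have h : meanSqError μ Φ x g k ≤ c₁ + (k % n : ℕ) * c₂ := by
    induction k with
    | zero =>
      exact (run.meanSqError_epoch hη hS₁ hG hV₁ hk (Nat.zero_mod n)).trans le_self_add
    | succ k ih =>
      by_cases hkn : (k + 1) % n = 0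
      · exact (run.meanSqError_epoch hη hS₁ hG hV₁ hk hkn).trans le_self_add
      · have h1 := run.meanSqError_succ hη hΓ hS₁ hS₂ hG hV₂ hk hkn
        have h2 : (k + 1) % n = k % n + 1 := by
          have hlt := Nat.mod_lt k hn
          rw [Nat.add_mod] at hkn ⊢
          rcases Nat.lt_or_ge 1 n with h1n | h1n
          · rw [Nat.mod_eq_of_lt h1n] at hkn ⊢
            rcases Nat.lt_or_ge (k % n + 1) n with h3 | h3
            · exact Nat.mod_eq_of_lt h3
            · have : k % n + 1 = n := by lia
              rw [this, Nat.mod_self] at hkn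
              exact absurd rfl hkn
          · have : n = 1 := by lia
            subst this
            simp [Nat.mod_one] at hkn
        rw [h2]
        push_cast
        rw [add_mul, one_mul, ← add_assoc]
        exact h1.trans (by gcongr; exact ih (Nat.lt_of_succ_lt hk))
  refine h.trans ?_
  gcongr
  exact (Nat.mod_lt k hn).le

end Run

/-! ### Scalar recursions and the uniform output index -/

theorem le_of_contraction {η c : ℝ} (hη : η ∈ Icc (0 : ℝ) 1) (hc : 0 ≤ c) {K : ℕ} {Δ : ℕ → ℝ}
    (h : ∀ k < K, Δ (k + 1) ≤ (1 - η) * Δ k + η * c) {k : ℕ} (hk : k ≤ K) :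
    Δ k ≤ (1 - η) ^ k * Δ 0 + c := by
  induction k with
  | zero => simpa using hc
  | succ k ih =>
    have h1 := h k hk
    have h2 := mul_le_mul_of_nonneg_left (ih (Nat.le_of_succ_le hk)) (sub_nonneg.2 hη.2)
    rw [pow_succ]
    linarith

/-- The recursion reads `η Δ_k ≤ Δ_k - Δ_{k+1} + η c`, which telescopes. -/
theorem sum_le_of_contraction {η c : ℝ} {K : ℕ} {Δ : ℕ → ℝ}
    (h : ∀ k < K, Δ (k + 1) ≤ (1 - η) * Δ k + η * c) {k : ℕ} (hk : k ≤ K) :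
    η * ∑ i ∈ Finset.range k, Δ i ≤ Δ 0 - Δ k + k * (η * c) := by
  induction k with
  | zero => simp
  | succ k ih =>
    have h1 := h k hk
    have h2 := ih (Nat.le_of_succ_le hk)
    rw [Finset.sum_range_succ]
    push_cast
    linarith

/-- With `r = √K` and `K = r²`, the power is at most `exp (-r)`, and `exp r ≥ r + 1`. -/
theorem one_sub_inv_sqrt_pow_le {K : ℕ} (hK : 0 < K) :
    (1 - 1 / √(K : ℝ)) ^ K ≤ 1 / √(K : ℝ) := by
  have hs : 0 < √(K : ℝ) := Real.sqrt_pos.2 (by exact_mod_cast hK)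
  have hs1 : 1 ≤ √(K : ℝ) := Real.one_le_sqrt.2 (by exact_mod_cast hK)
  have h0 : 0 ≤ 1 - 1 / √(K : ℝ) := sub_nonneg.2 ((div_le_one hs).2 hs1)
  have h1 : 1 - 1 / √(K : ℝ) ≤ Real.exp (-(1 / √(K : ℝ))) := by
    have := Real.add_one_le_exp (-(1 / √(K : ℝ)))
    linarith
  calc (1 - 1 / √(K : ℝ)) ^ K ≤ Real.exp (-(1 / √(K : ℝ))) ^ K := pow_le_pow_left₀ h0 h1 K
    _ = Real.exp (-√(K : ℝ)) := by
      rw [← Real.exp_nat_mul]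
      congr 1
      rw [mul_neg, mul_one_div, Real.div_sqrt]
    _ ≤ 1 / √(K : ℝ) := by
      rw [Real.exp_neg, ← one_div]
      refine one_div_le_one_div_of_le hs ?_
      linarith [Real.add_one_le_exp √(K : ℝ)]

theorem integral_uniform_index {Ω : Type*} {m : MeasurableSpace Ω} [mΩ : MeasurableSpace Ω]
    {μ : Measure Ω} [IsProbabilityMeasure μ] {K : ℕ} {out : Ω → Fin K}
    (hout : Measurable out) (hlaw : ∀ j, μ {w | out w = j} = (K : ENNReal)⁻¹)
    (hind : Indep (MeasurableSpace.comap out ⊤) m μ) {f : ℕ → Ω → ℝ}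
    (hf : ∀ k < K, Measurable[m] (f k)) (hfi : ∀ k < K, Integrable (f k) μ) :
    Integrable (fun w => f (out w) w) μ ∧
      ∫ w, f (out w) w ∂μ = (K : ℝ)⁻¹ * ∑ k ∈ Finset.range K, ∫ w, f k w ∂μ := by
  have hset : ∀ j : Fin K, MeasurableSet {w | out w = j} := fun j =>
    hout (measurableSet_singleton j)
  have hdecomp : (fun w => f (out w) w) =
      fun w => ∑ j : Fin K, ({w | out w = j} : Set Ω).indicator (f (j : ℕ)) w := by
    ext w
    rw [Finset.sum_eq_single (out w)]
    · simp
    · intro j _ hj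
      have h : w ∉ {w | out w = j} := fun h : out w = j => hj h.symm
      exact indicator_of_notMem h (f (j : ℕ))
    · simp
  have hint : ∀ j : Fin K, Integrable ({w | out w = j}.indicator (f j)) μ := fun j =>
    (hfi j j.2).indicator (hset j)
  have hval : ∀ j : Fin K, ∫ w, {w | out w = j}.indicator (f j) w ∂μ =
      (K : ℝ)⁻¹ * ∫ w, f j w ∂μ := by
    intro j
    have h1 : {w | out w = j}.indicator (f j) =
        fun w => (if out w = j then (1 : ℝ) else 0) * f j w := by
      ext w
      by_cases h : out w = j <;> simp [h]
    have hif : IndepFun (fun w => if out w = j then (1 : ℝ) else 0) (f j) μ := by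
      have h2 : IndepFun out (f j) μ := by
        rw [IndepFun_iff_Indep]
        exact indep_of_indep_of_le_right hind (hf j j.2).comap_le
      exact h2.comp (φ := fun i : Fin K => if i = j then (1 : ℝ) else 0) (ψ := id)
        (Measurable.of_discrete) measurable_id
    have hmi : Measurable fun w => if out w = j then (1 : ℝ) else 0 :=
      Measurable.ite (hset j) measurable_const measurable_const
    rw [h1, hif.integral_fun_mul_eq_mul_integral hmi.aestronglyMeasurable
      (hfi j j.2).aestronglyMeasurable]
    congr 1
    have h3 : (fun w => if out w = j then (1 : ℝ) else 0) =
        {w | out w = j}.indicator fun _ => (1 : ℝ) := by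
      ext w
      by_cases h : out w = j <;> simp [h]
    rw [h3, integral_indicator_const _ (hset j), measureReal_def, hlaw j]
    simp
  rw [hdecomp]
  refine ⟨integrable_finsetSum _ fun j _ => hint j, ?_⟩
  rw [integral_finsetSum _ fun j _ => hint j]
  simp only [hval]
  rw [← Finset.mul_sum, Finset.sum_range fun k => ∫ w, f k w ∂μ]

/-! ### The Frank–Wolfe recursion and the gap bound -/

section Gap

variable {E : Type*} [NormedAddCommGroup E] [NormedSpace ℝ E] [FiniteDimensional ℝ E]
  {M : Type*} [MetricSpace M] [SecondCountableTopology M] [ChartedSpace E M]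
  [IsManifold 𝓘(ℝ, E) ∞ M]
  [RiemannianBundle (fun x : M => TangentSpace 𝓘(ℝ, E) x)]
  [IsContMDiffRiemannianBundle 𝓘(ℝ, E) ∞ E (fun x : M => TangentSpace 𝓘(ℝ, E) x)]
  [IsRiemannianManifold 𝓘(ℝ, E) M]
  [MeasurableSpace M] [BorelSpace M]
  {X : Set M} {geo : GeodesicMaps E X}
  {Ξ : Type*} [MeasurableSpace Ξ] {P : Measure Ξ}
  {S₁ : (ℕ → Ξ) → ∀ x : M, TangentSpace 𝓘(ℝ, E) x}
  {S₂ : ℝ → (ℕ → Ξ) → ∀ x : M, TangentSpace 𝓘(ℝ, E) x}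
  {L η ε : ℝ} {n K : ℕ} {Ω : Type*} [mΩ : MeasurableSpace Ω] {μ : Measure Ω}
  [IsProbabilityMeasure μ] {ℱ : Filtration ℕ mΩ}
  {ξ : ℕ → ℕ → Ω → Ξ} {x : ℕ → Ω → M} {g : ∀ (k : ℕ) (w : Ω), TangentSpace 𝓘(ℝ, E) (x k w)}
  {z : ℕ → Ω → M} {out : Ω → Fin K}

theorem LSmoothOn.continuousOn {f : M → ℝ} (hf : LSmoothOn geo L f) : ContinuousOn f X :=
  fun x hx => (hf.1 x hx).continuousAt.continuousWithinAt

/-- The true gradient is exchanged for `g k` twice, once at the oracle point and once at `xstar`.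
Each exchange costs at most the diameter times the gradient error, hence the factor `2`. -/
theorem IsRun.gap_succ_le (run : IsRun geo P S₁ S₂ L η ε n K μ ℱ ξ x g z out)
    (hη : η ∈ Icc (0 : ℝ) 1) (hXc : IsCompact X) (hXg : GeodesicallyConvex E X) (hL : 0 ≤ L)
    {Φ : M → ℝ} (hΦ : LSmoothOn geo L Φ) (hconv : GConvexOn geo Φ) {xstar : M}
    (hxs : xstar ∈ X) {k : ℕ} (hk : k < K) (w : Ω) :
    Φ (x (k + 1) w) - Φ xstar ≤ (1 - η) * (Φ (x k w) - Φ xstar) +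
      η * (2 * Metric.diam X * ‖g k w - grad E Φ (x k w)‖ + L * Metric.diam X ^ 2 * η / 2) := by
  have hx := run.mem hη hk.le w
  have hz := run.oracle_mem k hk w
  have hD : ∀ y ∈ X, ‖geo.Log (x k w) y‖ ≤ Metric.diam X := fun y hy => by
    rw [GeodesicMaps.norm_log hx hy]
    exact Metric.dist_le_diam_of_mem hXc.isBounded hx hy
  have h1 := hΦ.descent hXg hx hz hη
  rw [← run.step k hk w] at h1
  have h2 : inner ℝ (g k w) (geo.Log (x k w) (z k w)) ≤
      inner ℝ (g k w) (geo.Log (x k w) xstar) := run.oracle_min k hk w hxs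
  have h3 := hconv _ hx _ hxs
  have h4 : ∀ y ∈ X, |inner ℝ (g k w - grad E Φ (x k w)) (geo.Log (x k w) y)| ≤
      ‖g k w - grad E Φ (x k w)‖ * Metric.diam X := fun y hy =>
    (abs_real_inner_le_norm _ _).trans (mul_le_mul_of_nonneg_left (hD y hy) (norm_nonneg _))
  have h5 := (abs_le.1 (h4 _ hz)).1
  have h6 := (abs_le.1 (h4 _ hxs)).2
  rw [inner_sub_left] at h5 h6
  have h7 : inner ℝ (grad E Φ (x k w)) (geo.Log (x k w) (z k w)) ≤
      2 * Metric.diam X * ‖g k w - grad E Φ (x k w)‖ - (Φ (x k w) - Φ xstar) := by linarith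
  have h8 := mul_le_mul_of_nonneg_left h7 hη.1
  have h9 : L * dist (x k w) (z k w) ^ 2 * η ^ 2 / 2 ≤ L * Metric.diam X ^ 2 * η ^ 2 / 2 := by
    have := Metric.dist_le_diam_of_mem hXc.isBounded hx hz
    gcongr
  linarith

theorem IsRun.gapBound [Nonempty M]
    (run : IsRun geo P S₁ S₂ L (1 / √(K : ℝ)) ε n K μ ℱ ξ x g z out)
    (hK : 0 < K) (hn : 0 < n) (hXc : IsCompact X) (hXg : GeodesicallyConvex E X)
    (hΓ : MeasurableTransport geo) (hS₁ : MeasurableEstimator X S₁)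
    (hS₂ : MeasurableSizedEstimator X S₂) (hL : 0 ≤ L) {Φ : M → ℝ} (hΦ : LSmoothOn geo L Φ)
    (hconv : GConvexOn geo Φ) {xstar : M} (hxs : xstar ∈ X)
    (hmin : IsMinOn Φ X xstar) {b : ℝ}
    (hb : ∀ x ∈ X, |Φ x - Φ xstar| ≤ b)
    (hG : Measurable fun x : X => (⟨x, grad E Φ x⟩ : TangentBundle 𝓘(ℝ, E) M)) {c₁ c₂ : ℝ}
    (hc₁ : 0 ≤ c₁) (hc₂ : 0 ≤ c₂)
    (hV₁ : ∀ ζ : ℕ → Ω → Ξ, IsSample P μ ζ → ∀ x ∈ X,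
      ∫⁻ w, ENNReal.ofReal (‖S₁ (fun i => ζ i w) x - grad E Φ x‖ ^ 2) ∂μ ≤
        ENNReal.ofReal (c₁ / K))
    (hV₂ : ∀ ζ : ℕ → Ω → Ξ, IsSample P μ ζ → ∀ x ∈ X, ∀ y ∈ X, ∀ u : TangentSpace 𝓘(ℝ, E) x,
      ∫⁻ w, ENNReal.ofReal (‖S₂ (2 * n * L ^ 2 * dist x y / ε ^ 2) (fun i => ζ i w) y -
        geo.Γ x y (S₂ (2 * n * L ^ 2 * dist x y / ε ^ 2) (fun i => ζ i w) x - u) -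
          grad E Φ y‖ ^ 2) ∂μ ≤ ENNReal.ofReal (‖u - grad E Φ x‖ ^ 2 + c₂ / (n * K))) :
    GapBound μ Φ xstar x out
      (b + (Metric.diam X * (c₁ + c₂ + 1) + L * Metric.diam X ^ 2 / 2)) := by
  borelize E
  have hK0 : (0 : ℝ) < K := by exact_mod_cast hK
  have hn0 : (0 : ℝ) < n := by exact_mod_cast hn
  set r := √(K : ℝ) with hr
  have hr0 : 0 < r := Real.sqrt_pos.2 hK0
  have hr1 : 1 ≤ r := Real.one_le_sqrt.2 (by exact_mod_cast hK)
  have hrr : r * r = K := Real.mul_self_sqrt hK0.le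
  have hη : 1 / r ∈ Icc (0 : ℝ) 1 := ⟨by positivity, (div_le_one hr0).2 hr1⟩
  have hD0 : 0 ≤ Metric.diam X := Metric.diam_nonneg
  have hmeas : ∀ k ≤ K, Measurable[ℱ K] fun w => Φ (x k w) - Φ xstar := by
    intro k hk
    have h1 : Measurable fun y : X => Φ y - Φ xstar :=
      ((continuousOn_iff_continuous_domRestrict.1 hΦ.continuousOn).measurable).sub_const _
    exact h1.comp (((run.adapted k hk).mono (ℱ.mono hk) le_rfl).subtype_mk
      (h := run.mem hη hk))
  have hint : ∀ k ≤ K, Integrable (fun w => Φ (x k w) - Φ xstar) μ := fun k hk =>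
    Integrable.of_bound ((hmeas k hk).mono (ℱ.le K) le_rfl).aestronglyMeasurable b
      (Eventually.of_forall fun w => hb _ (run.mem hη hk w))
  have hbk : ∀ k ≤ K, |∫ w, (Φ (x k w) - Φ xstar) ∂μ| ≤ b := fun k hk => by
    have := norm_integral_le_of_norm_le_const (μ := μ) (f := fun w => Φ (x k w) - Φ xstar)
      (Eventually.of_forall fun w => hb _ (run.mem hη hk w))
    simpa using this
  -- the mean error of the gradient estimates
  have herr : ∀ k < K, Integrable (fun w => ‖g k w - grad E Φ (x k w)‖) μ ∧
      ∫ w, ‖g k w - grad E Φ (x k w)‖ ∂μ ≤ (c₁ + c₂ + 1) / (2 * r) := by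
    intro k hk
    have hgm : Measurable fun w => ‖g k w - grad E Φ (x k w)‖ := by
      refine measurable_field_norm (measurable_field_sub
        ((run.measurable_g hη hΓ hS₁ hS₂ hk).mono (ℱ.le _) le_rfl) ?_)
      exact hG.comp (((run.adapted k hk.le).mono (ℱ.le _) le_rfl).subtype_mk
        (h := run.mem hη hk.le))
    have hV := run.meanSqError_le hη hn hΓ hS₁ hS₂ hG hV₁
      (c₂ := ENNReal.ofReal (c₂ / (n * K))) (fun ζ hζ x hx y hy u => by
        rw [← ENNReal.ofReal_add (by positivity) (by positivity)]
        exact hV₂ ζ hζ x hx y hy u) hk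
    have hV' : meanSqError μ Φ x g k ≤ ENNReal.ofReal ((c₁ + c₂) / K) := by
      refine hV.trans_eq ?_
      rw [← ENNReal.ofReal_natCast n, ← ENNReal.ofReal_mul hn0.le,
        ← ENNReal.ofReal_add (by positivity) (by positivity)]
      congr 1
      field_simp
    -- Integrability of the error is a consequence of the bound, which is why the bound was proved
    -- for the extended integral.
    have hsq : Integrable (fun w => ‖g k w - grad E Φ (x k w)‖ ^ 2) μ := by
      refine ⟨(hgm.pow_const 2).aestronglyMeasurable, ?_⟩
      rw [hasFiniteIntegral_iff_ofReal (Eventually.of_forall fun w => by positivity)]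
      exact hV'.trans_lt ENNReal.ofReal_lt_top
    have hsq' : ∫ w, ‖g k w - grad E Φ (x k w)‖ ^ 2 ∂μ ≤ (c₁ + c₂) / K := by
      rw [integral_eq_lintegral_of_nonneg_ae (Eventually.of_forall fun w => by positivity)
        hsq.aestronglyMeasurable]
      exact ENNReal.toReal_le_of_le_ofReal (by positivity) hV'
    -- Young's inequality with weight `r` passes from second to first moment in place of
    -- Cauchy–Schwarz; it makes `c₁ + c₂ + 1` appear instead of a square root.
    have hpt : ∀ w, ‖g k w - grad E Φ (x k w)‖ ≤
        r / 2 * ‖g k w - grad E Φ (x k w)‖ ^ 2 + 1 / (2 * r) := by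
      intro w
      have h1 := sq_nonneg (r * ‖g k w - grad E Φ (x k w)‖ - 1)
      have h2 : r / 2 * ‖g k w - grad E Φ (x k w)‖ ^ 2 + 1 / (2 * r) -
          ‖g k w - grad E Φ (x k w)‖ = (r * ‖g k w - grad E Φ (x k w)‖ - 1) ^ 2 / (2 * r) := by
        field_simp
        ring
      have h3 : 0 ≤ (r * ‖g k w - grad E Φ (x k w)‖ - 1) ^ 2 / (2 * r) := by positivity
      linarith
    have hrhs : Integrable (fun w => r / 2 * ‖g k w - grad E Φ (x k w)‖ ^ 2 + 1 / (2 * r)) μ :=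
      (hsq.const_mul _).add (integrable_const _)
    have hi : Integrable (fun w => ‖g k w - grad E Φ (x k w)‖) μ :=
      hrhs.mono' hgm.aestronglyMeasurable (Eventually.of_forall fun w => by
        rw [norm_norm]; exact hpt w)
    refine ⟨hi, (integral_mono hi hrhs hpt).trans ?_⟩
    rw [integral_add (hsq.const_mul _) (integrable_const _), integral_const_mul]
    simp only [integral_const, probReal_univ, smul_eq_mul, one_mul]
    have h4 := mul_le_mul_of_nonneg_left hsq' (show 0 ≤ r / 2 by positivity)
    refine (add_le_add_left h4 _).trans_eq ?_
    rw [← hrr]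
    field_simp
  set C := Metric.diam X * (c₁ + c₂ + 1) + L * Metric.diam X ^ 2 / 2 with hC
  have hC0 : 0 ≤ C := by positivity
  have hrec : ∀ k < K, ∫ w, (Φ (x (k + 1) w) - Φ xstar) ∂μ ≤
      (1 - 1 / r) * ∫ w, (Φ (x k w) - Φ xstar) ∂μ + 1 / r * (C / r) := by
    intro k hk
    obtain ⟨hi, hle⟩ := herr k hk
    have i1 := (hint k hk.le).const_mul (1 - 1 / r)
    have i2 : Integrable (fun w => 2 * Metric.diam X * ‖g k w - grad E Φ (x k w)‖ +
      L * Metric.diam X ^ 2 * (1 / r) / 2) μ := (hi.const_mul _).add (integrable_const _)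
    have h1 := integral_mono (hint (k + 1) hk) (i1.add (i2.const_mul (1 / r)))
      fun w => run.gap_succ_le hη hXc hXg hL hΦ hconv hxs hk w
    simp only [Pi.add_apply] at h1
    rw [integral_add i1 (i2.const_mul (1 / r)), integral_const_mul, integral_const_mul,
      integral_add (hi.const_mul _) (integrable_const _), integral_const_mul] at h1
    simp only [integral_const, probReal_univ, smul_eq_mul, one_mul] at h1
    refine h1.trans ?_
    have h2 := mul_le_mul_of_nonneg_left hle (show 0 ≤ 2 * Metric.diam X by positivity)
    have h3 : 2 * Metric.diam X * ((c₁ + c₂ + 1) / (2 * r)) +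
        L * Metric.diam X ^ 2 * (1 / r) / 2 = C / r := by
      rw [hC]
      field_simp
    have h4 := mul_le_mul_of_nonneg_left
      (show 2 * Metric.diam X * ∫ w, ‖g k w - grad E Φ (x k w)‖ ∂μ +
        L * Metric.diam X ^ 2 * (1 / r) / 2 ≤ C / r by linarith) hη.1
    linarith
  have hlast : ∫ w, (Φ (x K w) - Φ xstar) ∂μ ≤ (b + C) / r := by
    have h1 := le_of_contraction (c := C / r) (Δ := fun k => ∫ w, (Φ (x k w) - Φ xstar) ∂μ)
      hη (by positivity) hrec le_rfl
    have h2 : (1 - 1 / r) ^ K * ∫ w, (Φ (x 0 w) - Φ xstar) ∂μ ≤ 1 / r * b := by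
      have h0 := abs_le.1 (hbk 0 (Nat.zero_le K))
      have hb0 : 0 ≤ b := (abs_nonneg _).trans (hbk 0 (Nat.zero_le K))
      calc (1 - 1 / r) ^ K * ∫ w, (Φ (x 0 w) - Φ xstar) ∂μ ≤ (1 - 1 / r) ^ K * b :=
            mul_le_mul_of_nonneg_left h0.2 (pow_nonneg (sub_nonneg.2 hη.2) K)
        _ ≤ 1 / r * b := mul_le_mul_of_nonneg_right (one_sub_inv_sqrt_pow_le hK) hb0
    rw [add_div]
    linarith [show 1 / r * b = b / r by ring]
  obtain ⟨o1, o2⟩ := integral_uniform_index (f := fun k w => Φ (x k w) - Φ xstar)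
    run.out_measurable run.out_law run.out_indep (fun k hk => hmeas k hk.le)
    fun k hk => hint k hk.le
  refine ⟨⟨o1, ?_⟩, hint K le_rfl, hlast⟩
  have h1 := sum_le_of_contraction (Δ := fun k => ∫ w, (Φ (x k w) - Φ xstar) ∂μ) hrec le_rfl
  -- Minimality of `xstar` lets the final term of the telescoped sum be dropped.
  have h2 : 0 ≤ ∫ w, (Φ (x K w) - Φ xstar) ∂μ :=
    integral_nonneg fun w => sub_nonneg.2 (hmin (run.mem hη le_rfl w))
  have h3 := (abs_le.1 (hbk 0 (Nat.zero_le K))).2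
  have h4 : (K : ℝ) * (1 / r * (C / r)) = C := by
    rw [← hrr]
    field_simp
  rw [h4] at h1
  rw [o2]
  set s := ∑ k ∈ Finset.range K, ∫ w, (Φ (x k w) - Φ xstar) ∂μ
  calc (K : ℝ)⁻¹ * s = 1 / r * (1 / r * s) := by
        rw [← hrr]
        field_simp
    _ ≤ 1 / r * (b + C) := mul_le_mul_of_nonneg_left (by linarith) hη.1
    _ = (b + C) / r := by ring

end Gap

/-! ### Measurability and variance of the batch gradients -/

theorem integral_uniformOn_univ {H : Type*} [NormedAddCommGroup H] [NormedSpace ℝ H]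
    [CompleteSpace H] {m : ℕ} (f : Fin m → H) :
    ∫ i, f i ∂(uniformOn (Set.univ : Set (Fin m))) = (m : ℝ)⁻¹ • ∑ i, f i := by
  have h : uniformOn (Set.univ : Set (Fin m)) = (m : ENNReal)⁻¹ • Measure.count := by
    rw [uniformOn, ProbabilityTheory.cond, Measure.restrict_univ, Measure.count_univ]
    simp
  rw [h, integral_smul_measure, integral_count]
  simp

section Estimators

variable {E : Type*} [NormedAddCommGroup E] [NormedSpace ℝ E] [FiniteDimensional ℝ E]
  {M : Type*} [MetricSpace M] [SecondCountableTopology M] [ChartedSpace E M]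
  [IsManifold 𝓘(ℝ, E) ∞ M]
  [RiemannianBundle (fun x : M => TangentSpace 𝓘(ℝ, E) x)]
  [MeasurableSpace M] [BorelSpace M] [Nonempty M]
  {X : Set M} {geo : GeodesicMaps E X}
  {Ξ : Type*} [MeasurableSpace Ξ] {P : Measure Ξ} {φ : M → Ξ → ℝ}

theorem measurableEstimator_batchGrad
    (hφ : Measurable fun q : X × Ξ =>
      (⟨q.1, grad E (fun x => φ x q.2) q.1⟩ : TangentBundle 𝓘(ℝ, E) M)) (b : ℕ) :
    MeasurableEstimator (E := E) X (batchGrad φ b) := by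
  borelize E
  exact measurable_field_smul (measurable_field_sum _
    (measurable_subtype_coe.comp measurable_snd) fun i _ => hφ.comp
      (measurable_snd.prodMk ((measurable_pi_apply i).comp measurable_fst))) _

theorem measurableSizedEstimator_batchGrad
    (hφ : Measurable fun q : X × Ξ =>
      (⟨q.1, grad E (fun x => φ x q.2) q.1⟩ : TangentBundle 𝓘(ℝ, E) M)) :
    MeasurableSizedEstimator (E := E) X fun r => batchGrad φ ⌈r⌉₊ :=
  measurable_select (h := fun b (q : ℝ × (ℕ → Ξ) × X) =>
      (⟨q.2.2, batchGrad φ b q.2.1 q.2.2⟩ : TangentBundle 𝓘(ℝ, E) M))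
    (fun b => (measurableEstimator_batchGrad hφ b).comp measurable_snd)
    (Nat.measurable_ceil.comp measurable_fst)

theorem measurableSizedEstimator_cappedBatchGrad {m : ℕ} {φ : M → Fin m → ℝ}
    (hφ : Measurable fun q : X × Fin m =>
      (⟨q.1, grad E (fun x => φ x q.2) q.1⟩ : TangentBundle 𝓘(ℝ, E) M)) :
    MeasurableSizedEstimator (E := E) X (cappedBatchGrad φ) := by
  borelize E
  refine measurable_select (h := fun b (q : ℝ × (ℕ → Fin m) × X) =>
      (⟨q.2.2, if b = m then (m : ℝ)⁻¹ • ∑ i, grad E (fun x' => φ x' i) q.2.2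
        else batchGrad φ b q.2.1 q.2.2⟩ : TangentBundle 𝓘(ℝ, E) M))
    (fun b => ?_) (Nat.measurable_ceil.comp (measurable_const.min measurable_fst))
  by_cases hb : b = m
  · simp only [hb, if_true]
    exact measurable_field_smul (measurable_field_sum _
      (measurable_subtype_coe.comp (measurable_snd.comp measurable_snd)) fun i _ => hφ.comp
        ((measurable_snd.comp measurable_snd).prodMk measurable_const)) _
  · simp only [hb, if_false]
    exact (measurableEstimator_batchGrad hφ b).comp measurable_snd

/-- The field `grad Φ` is the mean of a jointly measurable field. Coordinates commute with the
integral, so measurability follows from that of parametric integrals. -/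
theorem measurable_mean_grad [SFinite P]
    (hφ : Measurable fun q : X × Ξ =>
      (⟨q.1, grad E (fun x => φ x q.2) q.1⟩ : TangentBundle 𝓘(ℝ, E) M)) {Φ : M → ℝ}
    (hmean : ∀ x ∈ X, ∫ ξ, grad E (fun x => φ x ξ) x ∂P = grad E Φ x) :
    Measurable fun x : X => (⟨x, grad E Φ x⟩ : TangentBundle 𝓘(ℝ, E) M) := by
  borelize E
  rw [measurable_field_iff]
  refine ⟨measurable_subtype_coe, ?_⟩
  have h1 : Measurable fun q : X × Ξ =>
      fiberCoord (E := E) (q.1 : M) (grad E (fun x => φ x q.2) q.1) :=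
    (measurable_field_iff.1 hφ).2
  have h2 := (h1.stronglyMeasurable.integral_prod_right' (ν := P)).measurable
  convert h2 using 2 with x
  rw [← hmean x x.2]
  exact (ContinuousLinearEquiv.integral_comp_comm (fiberCoord (E := E) (x : M)) _).symm

theorem aestronglyMeasurable_grad
    (hφ : Measurable fun q : X × Ξ =>
      (⟨q.1, grad E (fun x => φ x q.2) q.1⟩ : TangentBundle 𝓘(ℝ, E) M)) {x : M} (hx : x ∈ X) :
    AEStronglyMeasurable (fun ξ => grad E (fun x => φ x ξ) x) P := by
  borelize E
  have h1 : Measurable fun q : X × Ξ =>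
      fiberCoord (E := E) (q.1 : M) (grad E (fun x => φ x q.2) q.1) :=
    (measurable_field_iff.1 hφ).2
  have h2 : Measurable fun ξ => fiberCoord (E := E) x (grad E (fun x => φ x ξ) x) :=
    Measurable.comp (f := fun ξ : Ξ => ((⟨x, hx⟩ : X), ξ)) h1 measurable_prodMk_left
  let e := fiberCoord (E := E) x
  have h3 : StronglyMeasurable fun ξ => e.symm (e (grad E (fun x => φ x ξ) x)) :=
    e.symm.continuous.comp_stronglyMeasurable h2.stronglyMeasurable
  have h4 : (fun ξ => e.symm (e (grad E (fun x => φ x ξ) x))) =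
    fun ξ => grad E (fun x => φ x ξ) x := funext fun ξ => e.symm_apply_apply _
  rw [h4] at h3
  exact h3.aestronglyMeasurable

variable [IsProbabilityMeasure P] {Ω : Type*} [MeasurableSpace Ω] {μ : Measure Ω}
  [IsProbabilityMeasure μ] {ζ : ℕ → Ω → Ξ} {Φ : M → ℝ} {C : ℝ}

theorem IsSample.lintegral_batchGrad_le (hζ : IsSample P μ ζ)
    (hφ : Measurable fun q : X × Ξ =>
      (⟨q.1, grad E (fun x => φ x q.2) q.1⟩ : TangentBundle 𝓘(ℝ, E) M))
    (hC : ∀ᵐ ξ ∂P, ∀ x ∈ X, ‖grad E (fun x => φ x ξ) x‖ ≤ C)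
    (hmean : ∀ x ∈ X, ∫ ξ, grad E (fun x => φ x ξ) x ∂P = grad E Φ x)
    {b : ℕ} {s : ℝ} (hs : 0 ≤ s) (hb : 4 * C ^ 2 ≤ b * s) {x : M} (hx : x ∈ X) :
    ∫⁻ w, ENNReal.ofReal (‖batchGrad φ b (fun i => ζ i w) x - grad E Φ x‖ ^ 2) ∂μ ≤
      ENNReal.ofReal s := by
  have : FiniteDimensional ℝ (TangentSpace 𝓘(ℝ, E) x) := inferInstanceAs (FiniteDimensional ℝ E)
  have : CompleteSpace (TangentSpace 𝓘(ℝ, E) x) := FiniteDimensional.complete ℝ _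
  have key := lintegral_average_le hζ.measurable hζ.law hζ.iIndep
    (aestronglyMeasurable_grad hφ hx) (hC.mono fun ξ h => h x hx) hs hb
    (0 : TangentSpace 𝓘(ℝ, E) x)
  rw [hmean x hx] at key
  simpa [batchGrad] using key

variable [IsContMDiffRiemannianBundle 𝓘(ℝ, E) ∞ E (fun x : M => TangentSpace 𝓘(ℝ, E) x)]

/-- The new error is `Γ (u - grad Φ x)` plus the centred average of `grad φ(y,ξ) - Γ grad φ(x,ξ)`.
Smoothness of the components bounds these vectors by `L d(x, y)`, and `Γ` preserves the norm of the
shift. -/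
theorem IsSample.lintegral_batchGrad_transport_le (hζ : IsSample P μ ζ)
    (hφ : Measurable fun q : X × Ξ =>
      (⟨q.1, grad E (fun x => φ x q.2) q.1⟩ : TangentBundle 𝓘(ℝ, E) M))
    (hC : ∀ᵐ ξ ∂P, ∀ x ∈ X, ‖grad E (fun x => φ x ξ) x‖ ≤ C)
    (hmean : ∀ x ∈ X, ∫ ξ, grad E (fun x => φ x ξ) x ∂P = grad E Φ x)
    {L : ℝ} (hL : ∀ᵐ ξ ∂P, LSmoothOn geo L fun x => φ x ξ)
    {x y : M} (hx : x ∈ X) (hy : y ∈ X)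
    {b : ℕ} {s : ℝ} (hs : 0 ≤ s) (hb : 4 * (L * dist x y) ^ 2 ≤ b * s)
    (u : TangentSpace 𝓘(ℝ, E) x) :
    ∫⁻ w, ENNReal.ofReal (‖batchGrad φ b (fun i => ζ i w) y -
      geo.Γ x y (batchGrad φ b (fun i => ζ i w) x - u) - grad E Φ y‖ ^ 2) ∂μ ≤
      ENNReal.ofReal (‖u - grad E Φ x‖ ^ 2 + s) := by
  have hfin : ∀ x : M, FiniteDimensional ℝ (TangentSpace 𝓘(ℝ, E) x) := fun x =>
    inferInstanceAs (FiniteDimensional ℝ E)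
  have hcomp : ∀ x : M, CompleteSpace (TangentSpace 𝓘(ℝ, E) x) := fun x =>
    FiniteDimensional.complete ℝ _
  let T : TangentSpace 𝓘(ℝ, E) x →L[ℝ] TangentSpace 𝓘(ℝ, E) y := (geo.Γ x y).toContinuousLinearMap
  have hT : ∀ v, T v = geo.Γ x y v := fun v => rfl
  have hxm := aestronglyMeasurable_grad (P := P) hφ hx
  have hym := aestronglyMeasurable_grad (P := P) hφ hy
  have hxi : Integrable (fun ξ => grad E (fun x => φ x ξ) x) P :=
    Integrable.of_bound hxm C (hC.mono fun ξ h => h x hx)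
  have hyi : Integrable (fun ξ => grad E (fun x => φ x ξ) y) P :=
    Integrable.of_bound hym C (hC.mono fun ξ h => h y hy)
  have key := lintegral_average_le hζ.measurable hζ.law hζ.iIndep
    (h := fun ξ => grad E (fun x => φ x ξ) y - T (grad E (fun x => φ x ξ) x))
    (hyi.sub (T.integrable_comp hxi)).aestronglyMeasurable
    (hL.mono fun ξ h => h.2 x hx y hy) hs hb (geo.Γ x y (u - grad E Φ x))
  rw [integral_sub hyi (T.integrable_comp hxi), T.integral_comp_comm hxi, hmean x hx,
    hmean y hy, geo.norm_transport hx hy] at key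
  refine le_of_eq_of_le ?_ key
  congr with w
  congr 3
  simp only [batchGrad, hT, Finset.sum_sub_distrib, map_sub, map_smul, map_sum, smul_sub]
  abel

theorem IsSample.lintegral_cappedBatchGrad_transport_le {m : ℕ} {φ : M → Fin m → ℝ}
    [IsProbabilityMeasure (uniformOn (Set.univ : Set (Fin m)))] {ζ : ℕ → Ω → Fin m}
    (hζ : IsSample (uniformOn (Set.univ : Set (Fin m))) μ ζ)
    (hφ : Measurable fun q : X × Fin m =>
      (⟨q.1, grad E (fun x => φ x q.2) q.1⟩ : TangentBundle 𝓘(ℝ, E) M))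
    (hC : ∀ i, ∀ x ∈ X, ‖grad E (fun x => φ x i) x‖ ≤ C)
    (hmean : ∀ x ∈ X, grad E Φ x = (m : ℝ)⁻¹ • ∑ i, grad E (fun x => φ x i) x)
    {L : ℝ} (hL : ∀ i, LSmoothOn geo L fun x => φ x i)
    {x y : M} (hx : x ∈ X) (hy : y ∈ X)
    {r s : ℝ} (hs : 0 ≤ s) (hr : 4 * (L * dist x y) ^ 2 ≤ r * s)
    (u : TangentSpace 𝓘(ℝ, E) x) :
    ∫⁻ w, ENNReal.ofReal (‖cappedBatchGrad φ r (fun i => ζ i w) y -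
      geo.Γ x y (cappedBatchGrad φ r (fun i => ζ i w) x - u) - grad E Φ y‖ ^ 2) ∂μ ≤
      ENNReal.ofReal (‖u - grad E Φ x‖ ^ 2 + s) := by
  by_cases h : ⌈min (m : ℝ) r⌉₊ = m
  -- With the whole index set both batch gradients are exact, so the old error is merely
  -- transported.
  · have heq : ∀ w, ‖cappedBatchGrad φ r (fun i => ζ i w) y -
        geo.Γ x y (cappedBatchGrad φ r (fun i => ζ i w) x - u) - grad E Φ y‖ =
        ‖u - grad E Φ x‖ := fun w => by
      simp only [cappedBatchGrad, h, if_true, ← hmean x hx, ← hmean y hy]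
      rw [sub_right_comm, sub_self, zero_sub, norm_neg, geo.norm_transport hx hy, norm_sub_rev]
    simp only [heq, lintegral_const, measure_univ, mul_one]
    exact ENNReal.ofReal_le_ofReal (by linarith)
  · simp only [cappedBatchGrad, h, if_false]
    -- A batch below the cap was not truncated, so it has the requested size.
    have hrm : min (m : ℝ) r = r := by
      rcases min_choice (m : ℝ) r with h1 | h1
      · rw [h1, Nat.ceil_natCast] at h
        exact absurd rfl h
      · exact h1
    refine hζ.lintegral_batchGrad_transport_le hφ (ae_of_all _ hC) (fun x hx => ?_)
      (ae_of_all _ hL) hx hy hs (hr.trans ?_) u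
    · have : FiniteDimensional ℝ (TangentSpace 𝓘(ℝ, E) x) :=
        inferInstanceAs (FiniteDimensional ℝ E)
      have : CompleteSpace (TangentSpace 𝓘(ℝ, E) x) := FiniteDimensional.complete ℝ _
      rw [integral_uniformOn_univ, hmean x hx]
    · rw [hrm]
      exact mul_le_mul_of_nonneg_right (Nat.le_ceil r) hs

end Estimators

/-! ### Batch sizes and properties of the objectives -/

section Objectives

variable {E : Type*} [NormedAddCommGroup E] [NormedSpace ℝ E] [FiniteDimensional ℝ E]
  {M : Type*} [MetricSpace M] [SecondCountableTopology M] [ChartedSpace E M]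
  [IsManifold 𝓘(ℝ, E) ∞ M]
  [RiemannianBundle (fun x : M => TangentSpace 𝓘(ℝ, E) x)]
  [IsContMDiffRiemannianBundle 𝓘(ℝ, E) ∞ E (fun x : M => TangentSpace 𝓘(ℝ, E) x)]
  [IsRiemannianManifold 𝓘(ℝ, E) M]
  {X : Set M} {geo : GeodesicMaps E X}

theorem le_of_ceil_inv_sqrt {K b : ℕ} (hK : 0 < K) {ε a c : ℝ} (hε : ε = 1 / √(K : ℝ))
    (hb : b = ⌈a / ε ^ 2⌉₊) (hc : 0 ≤ c) : a * c ≤ b * (c / K) := by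
  have hK0 : (0 : ℝ) < K := by exact_mod_cast hK
  have h : a * K ≤ b := by
    rw [hb]
    refine le_trans (le_of_eq ?_) (Nat.le_ceil _)
    rw [hε, div_pow, Real.sq_sqrt hK0.le]
    field_simp
  calc a * c = a * K * (c / K) := by field_simp
    _ ≤ b * (c / K) := mul_le_mul_of_nonneg_right h (by positivity)

/-- The variance is quadratic in the step length `d` but the batch size only linear; the spare
factor `d` is bounded by the diameter, giving `c₂ = 2 D`. -/
theorem inner_batch_bound {K n : ℕ} (hK : 0 < K) (hn : 0 < n) {ε L d D r : ℝ}
    (hε : ε = 1 / √(K : ℝ)) (hd : 0 ≤ d) (hdD : d ≤ D) (hr : 2 * n * L ^ 2 * d / ε ^ 2 ≤ r) :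
    4 * (L * d) ^ 2 ≤ r * (2 * D / (n * K)) := by
  have hK0 : (0 : ℝ) < K := by exact_mod_cast hK
  have hn0 : (0 : ℝ) < n := by exact_mod_cast hn
  have hD : 0 ≤ D := hd.trans hdD
  calc 4 * (L * d) ^ 2 = 4 * L ^ 2 * d * d := by ring
    _ ≤ 4 * L ^ 2 * d * D := by gcongr
    _ = 2 * n * L ^ 2 * d / ε ^ 2 * (2 * D / (n * K)) := by
      rw [hε, div_pow, Real.sq_sqrt hK0.le]
      field_simp
      ring
    _ ≤ r * (2 * D / (n * K)) := by gcongr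

theorem LSmoothOn.norm_grad_le (hXc : IsCompact X) {L : ℝ} (hL : 0 ≤ L) {f : M → ℝ}
    (hf : LSmoothOn geo L f) {x y : M} (hx : x ∈ X) (hy : y ∈ X) :
    ‖grad E f y‖ ≤ ‖grad E f x‖ + L * Metric.diam X := by
  have h := hf.2 x hx y hy
  have h2 := norm_le_norm_add_norm_sub' (grad E f y) (geo.Γ x y (grad E f x))
  rw [geo.norm_transport hx hy] at h2
  have h3 : L * dist x y ≤ L * Metric.diam X :=
    mul_le_mul_of_nonneg_left (Metric.dist_le_diam_of_mem hXc.isBounded hx hy) hL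
  linarith

theorem LSmoothOn.average {m : ℕ} (hm : 0 < m) {L : ℝ} {φ : M → Fin m → ℝ} {Φ : M → ℝ}
    (hΦ : ∀ x, Φ x = (1 / (m : ℝ)) * ∑ i, φ x i)
    (hφ : ∀ i, LSmoothOn geo L fun x => φ x i) : LSmoothOn geo L Φ := by
  have hm0 : (0 : ℝ) < m := by exact_mod_cast hm
  have hg := fun x (hx : x ∈ X) => grad_average (E := E) (x := x) hΦ fun i => (hφ i).1 x hx
  refine ⟨fun x hx => (hg x hx).1, fun x hx y hy => ?_⟩
  rw [(hg x hx).2, (hg y hy).2, map_smul, map_sum, ← smul_sub, ← Finset.sum_sub_distrib, norm_smul,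
    Real.norm_of_nonneg (by positivity)]
  have h := norm_sum_le_of_le Finset.univ fun i _ => (hφ i).2 x hx y hy
  rw [Finset.sum_const, Finset.card_univ, Fintype.card_fin, nsmul_eq_mul] at h
  calc _ ≤ (m : ℝ)⁻¹ * (m * (L * dist x y)) := mul_le_mul_of_nonneg_left h (by positivity)
    _ = L * dist x y := by field_simp

variable [MeasurableSpace M] [BorelSpace M]

theorem LSmoothOn.exists_abs_sub_le (hXc : IsCompact X) {L : ℝ} {Φ : M → ℝ}
    (hΦ : LSmoothOn geo L Φ) (c : ℝ) : ∃ b, ∀ x ∈ X, |Φ x - c| ≤ b :=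
  hXc.exists_bound_of_continuousOn (hΦ.continuousOn.sub continuousOn_const)

end Objectives

end SpiderRFW

/-! ### The two problem classes -/

theorem mainTheorem7
    {E : Type*} [NormedAddCommGroup E] [NormedSpace ℝ E] [FiniteDimensional ℝ E]
    {M : Type*} [MetricSpace M] [SecondCountableTopology M] [ChartedSpace E M]
    [IsManifold 𝓘(ℝ, E) ∞ M]
    [RiemannianBundle (fun x : M => TangentSpace 𝓘(ℝ, E) x)]
    [IsContMDiffRiemannianBundle 𝓘(ℝ, E) ∞ E (fun x : M => TangentSpace 𝓘(ℝ, E) x)]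
    [IsRiemannianManifold 𝓘(ℝ, E) M]
    [MeasurableSpace M] [BorelSpace M]
    (X : Set M) (hXc : IsCompact X) (hXg : SpiderRFW.GeodesicallyConvex E X)
    (geo : SpiderRFW.GeodesicMaps E X) (hΓ : SpiderRFW.MeasurableTransport geo)
    (L : ℝ) (hL : 0 < L) :
    -- stochastic objectives
    (∀ (Ξ : Type*) [MeasurableSpace Ξ] (P : Measure Ξ) [IsProbabilityMeasure P]
      (φ : M → Ξ → ℝ) (Φ : M → ℝ) (C : ℝ) (xstar : M),
      (∀ x ∈ X, Integrable (φ x) P) → (∀ x, Φ x = ∫ ξ, φ x ξ ∂P) →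
      (Measurable fun q : X × Ξ =>
        (⟨q.1, SpiderRFW.grad E (fun x => φ x q.2) q.1⟩ : TangentBundle 𝓘(ℝ, E) M)) →
      (∀ᵐ ξ ∂P, SpiderRFW.LSmoothOn geo L (fun x => φ x ξ)) →
      (∀ᵐ ξ ∂P, ∀ x ∈ X, ‖SpiderRFW.grad E (fun x => φ x ξ) x‖ ≤ C) →
      (∀ x ∈ X, ∫ ξ, SpiderRFW.grad E (fun x => φ x ξ) x ∂P = SpiderRFW.grad E Φ x) →
      SpiderRFW.LSmoothOn geo L Φ → SpiderRFW.GConvexOn geo Φ →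
      xstar ∈ X → IsMinOn Φ X xstar →
      ∃ A : ℝ, ∀ (K : ℕ), 0 < K → ∀ (ε : ℝ), ε = 1 / √(K : ℝ) →
        ∀ (Ω : Type*) [mΩ : MeasurableSpace Ω] (μ : Measure Ω) [IsProbabilityMeasure μ]
          (ℱ : Filtration ℕ mΩ) (ξ : ℕ → ℕ → Ω → Ξ) (x : ℕ → Ω → M)
          (g : ∀ (k : ℕ) (w : Ω), TangentSpace 𝓘(ℝ, E) (x k w)) (z : ℕ → Ω → M)
          (out : Ω → Fin K),
          SpiderRFW.IsRun geo P
            (SpiderRFW.batchGrad φ ⌈2 * C ^ 2 / ε ^ 2⌉₊)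
            (fun r => SpiderRFW.batchGrad φ ⌈r⌉₊)
            L (1 / √(K : ℝ)) ε ⌈√(K : ℝ)⌉₊ K μ ℱ ξ x g z out →
          SpiderRFW.GapBound μ Φ xstar x out A) ∧
    -- finite-sum objectives
    (∀ (m : ℕ) (φ : M → Fin m → ℝ) (Φ : M → ℝ) (xstar : M),
      0 < m → (∀ x, Φ x = (1 / (m : ℝ)) * ∑ i, φ x i) →
      (Measurable fun q : X × Fin m =>
        (⟨q.1, SpiderRFW.grad E (fun x => φ x q.2) q.1⟩ : TangentBundle 𝓘(ℝ, E) M)) →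
      (∀ i, SpiderRFW.LSmoothOn geo L (fun x => φ x i)) → SpiderRFW.GConvexOn geo Φ →
      xstar ∈ X → IsMinOn Φ X xstar →
      ∃ A : ℝ, ∀ (K : ℕ), 0 < K → ∀ (ε : ℝ), ε = 1 / √(K : ℝ) →
        ∀ (Ω : Type*) [mΩ : MeasurableSpace Ω] (μ : Measure Ω) [IsProbabilityMeasure μ]
          (ℱ : Filtration ℕ mΩ) (ξ : ℕ → ℕ → Ω → Fin m) (x : ℕ → Ω → M)
          (g : ∀ (k : ℕ) (w : Ω), TangentSpace 𝓘(ℝ, E) (x k w)) (z : ℕ → Ω → M)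
          (out : Ω → Fin K),
          SpiderRFW.IsRun geo (uniformOn (Set.univ : Set (Fin m)))
            (SpiderRFW.batchGrad φ ⌈2 * L ^ 2 * Metric.diam X ^ 2 / ε ^ 2⌉₊)
            (SpiderRFW.cappedBatchGrad φ)
            L (1 / √(K : ℝ)) ε ⌈√(K : ℝ)⌉₊ K μ ℱ ξ x g z out →
          SpiderRFW.GapBound μ Φ xstar x out A) := by
  have hD : 0 ≤ Metric.diam X := Metric.diam_nonneg
  refine ⟨?_, ?_⟩
  · intro Ξ _ P _ φ Φ C xstar _ _ hφ hφL hC hmean hΦ hconv hxs hmin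
    have : Nonempty M := ⟨xstar⟩
    obtain ⟨b, hb⟩ := hΦ.exists_abs_sub_le hXc (Φ xstar)
    -- Here `c₁ = 2`, since a batch of at least `2 C² K` samples satisfies `4 C² ≤ |S₁| c₁ / K`, and
    -- `c₂` is twice the diameter.
    refine ⟨b + (Metric.diam X * (2 + 2 * Metric.diam X + 1) + L * Metric.diam X ^ 2 / 2), ?_⟩
    intro K hK ε hε Ω _ μ _ ℱ ξ x g z out run
    have hn : 0 < ⌈√(K : ℝ)⌉₊ := Nat.ceil_pos.2 (Real.sqrt_pos.2 (by exact_mod_cast hK))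
    refine run.gapBound hK hn hXc hXg hΓ (SpiderRFW.measurableEstimator_batchGrad hφ _)
      (SpiderRFW.measurableSizedEstimator_batchGrad hφ) hL.le hΦ hconv hxs hmin hb
      (SpiderRFW.measurable_mean_grad hφ hmean) zero_le_two (by positivity)
      (fun ζ hζ x hx => ?_) fun ζ hζ x hx y hy u => ?_
    · refine hζ.lintegral_batchGrad_le hφ hC hmean (by positivity) ?_ hx
      refine le_of_eq_of_le ?_ (SpiderRFW.le_of_ceil_inv_sqrt hK hε rfl zero_le_two)
      ring
    · exact hζ.lintegral_batchGrad_transport_le hφ hC hmean hφL hx hy (by positivity)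
        (SpiderRFW.inner_batch_bound hK hn hε dist_nonneg
          (Metric.dist_le_diam_of_mem hXc.isBounded hx hy) (Nat.le_ceil _)) u
  · intro m φ Φ xstar hm hΦeq hφ hφL hconv hxs hmin
    have : Nonempty M := ⟨xstar⟩
    have hprob : IsProbabilityMeasure (uniformOn (Set.univ : Set (Fin m))) :=
      isProbabilityMeasure_uniformOn Set.finite_univ ⟨⟨0, hm⟩, trivial⟩
    have hΦ := SpiderRFW.LSmoothOn.average hm hΦeq hφL
    have hgrad : ∀ x ∈ X, SpiderRFW.grad E Φ x =
        (m : ℝ)⁻¹ • ∑ i, SpiderRFW.grad E (fun x => φ x i) x := fun x hx =>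
      (SpiderRFW.grad_average hΦeq fun i => (hφL i).1 x hx).2
    have hmean : ∀ x ∈ X, ∫ i, SpiderRFW.grad E (fun x => φ x i) x
        ∂(uniformOn (Set.univ : Set (Fin m))) = SpiderRFW.grad E Φ x := fun x hx => by
      have : FiniteDimensional ℝ (TangentSpace 𝓘(ℝ, E) x) :=
        inferInstanceAs (FiniteDimensional ℝ E)
      have : CompleteSpace (TangentSpace 𝓘(ℝ, E) x) := FiniteDimensional.complete ℝ _
      rw [SpiderRFW.integral_uniformOn_univ, hgrad x hx]
    -- No gradient bound is assumed for finite sums; finitely many values at `xstar` and smoothness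
    -- over a bounded set provide one.
    set B : ℝ := ∑ i, ‖SpiderRFW.grad E (fun x => φ x i) xstar‖ + L * Metric.diam X with hB
    have hC : ∀ i, ∀ x ∈ X, ‖SpiderRFW.grad E (fun x => φ x i) x‖ ≤ B := fun i x hx => by
      refine ((hφL i).norm_grad_le hXc hL.le hxs hx).trans ?_
      have := Finset.single_le_sum
        (f := fun i => ‖SpiderRFW.grad E (fun x => φ x i) xstar‖)
        (fun i _ => norm_nonneg _) (Finset.mem_univ i)
      linarith
    obtain ⟨b, hb⟩ := hΦ.exists_abs_sub_le hXc (Φ xstar)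
    -- If the diameter is zero, the prescribed `S₁` is empty, but `X` is a single point and every
    -- gap vanishes.
    rcases hD.eq_or_lt with hD0 | hD0
    · refine ⟨0, fun K hK ε hε Ω _ μ _ ℱ ξ x g z out run => ?_⟩
      have hη : 1 / √(K : ℝ) ∈ Set.Icc (0 : ℝ) 1 := ⟨by positivity,
        (div_le_one (Real.sqrt_pos.2 (by exact_mod_cast hK))).2
          (Real.one_le_sqrt.2 (by exact_mod_cast hK))⟩
      have hx : ∀ k ≤ K, ∀ w, Φ (x k w) - Φ xstar = 0 := fun k hk w => by
        have h1 := Metric.dist_le_diam_of_mem hXc.isBounded (run.mem hη hk w) hxs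
        rw [← hD0] at h1
        rw [dist_le_zero.1 h1, sub_self]
      simp [SpiderRFW.GapBound, hx _ le_rfl, fun w => hx _ (out w).2.le w]
    -- The epoch batch is scaled by `L D` rather than by the gradient bound `B`, so `c₁ = 2 B² / (L²
    -- D²)` absorbs the ratio.
    · refine ⟨b + (Metric.diam X * (2 * B ^ 2 / (L ^ 2 * Metric.diam X ^ 2) + 2 * Metric.diam X + 1)
        + L * Metric.diam X ^ 2 / 2), ?_⟩
      intro K hK ε hε Ω _ μ _ ℱ ξ x g z out run
      have hn : 0 < ⌈√(K : ℝ)⌉₊ := Nat.ceil_pos.2 (Real.sqrt_pos.2 (by exact_mod_cast hK))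
      refine run.gapBound hK hn hXc hXg hΓ (SpiderRFW.measurableEstimator_batchGrad hφ _)
        (SpiderRFW.measurableSizedEstimator_cappedBatchGrad hφ) hL.le hΦ hconv hxs hmin hb
        (SpiderRFW.measurable_mean_grad hφ hmean) (by positivity) (by positivity)
        (fun ζ hζ x hx => ?_) fun ζ hζ x hx y hy u => ?_
      · refine hζ.lintegral_batchGrad_le hφ (ae_of_all _ hC) hmean (by positivity) ?_ hx
        refine le_of_eq_of_le ?_ (SpiderRFW.le_of_ceil_inv_sqrt hK hε rfl (by positivity))
        field_simp
        ring
      · exact hζ.lintegral_cappedBatchGrad_transport_le hφ hC hgrad hφL hx hy (by positivity)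
          (SpiderRFW.inner_batch_bound hK hn hε dist_nonneg
            (Metric.dist_le_diam_of_mem hXc.isBounded hx hy) le_rfl) u
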